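/- Let $t_0\ge 1$ be a finite number and let $Y=(Y_t)_{t\in[0,t_0]}$ be a real-valued Lévy process on a probability space $(\Omega,\mathcal F,P)$. For a Borel set $A\subseteq[0,t_0]$ let $\Lambda(A)=\int_A dY_s$, i.e. the limit in probability of the elementary integrals $\sum_i (Y_{b_i}-Y_{a_i})$ over finite disjoint unions $\bigcup_i(a_i,b_i]\subseteq[0,t_0]$ that approximate $A$ in Lebesgue measure. Let $I$ be the set of all $\xi=\{A_1,\dots,A_n\}$, $n\ge1$, where $A_1,\dots,A_n$ are disjoint Borel subsets of $[0,t_0]$ of positive Lebesgue measure, and put $\mathcal H_\xi=\{\Lambda(A_1),\dots,\Lambda(A_n)\}$ and $\mathcal H=\{\mathcal H_\xi\}_{\xi\in I}$. For $q\in(0,\infty)$, $\mathcal H$ is said to satisfy $C_q$ if there exist $\beta_1,\beta_2>0$ such that for every $Z\in\bigcup_{\xi\in I}\mathcal H_\xi$ there is $c_Z>0$ with $P(|Z|\ge c_Z)\ge\beta_1$ and $$E\big[|Z|^q,\,|Z|>s\big]\le \beta_2\, s^q\, P(|Z|>s)\qquad\text{for all } s\ge c_Z .$$ $\mathcal H$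 is said to satisfy $C_\infty$ if $\bigcup_{\xi\in I}\mathcal H_\xi\subseteq L^1$ and $\sup_{\xi\in I}\sup_{Z\in\mathcal H_\xi}\|Z-E[Z]\|_\infty/\|Z-E[Z]\|_2<\infty$ (a quotient with infinite numerator counts as infinite and $0/0$ as $0$). Here $\|X\|_p=E[|X|^p]^{1/p}$ for $p<\infty$ and $\|X\|_\infty$ is the essential supremum of $|X|$. For $\mu,\lambda>0$, $\mathrm{IG}(\mu,\lambda)$ is the distribution on $(0,\infty)$ with density $\big[\tfrac{\lambda}{2\pi x^3}\big]^{1/2}e^{-\lambda(x-\mu)^2/(2\mu^2x)}$, $x>0$. For $\alpha,\delta>0$, the symmetric normal inverse Gaussian distribution $\mathrm{NIG}(\alpha,0,0,\delta)$ is the distribution on $\mathbb R$ with density $$\frac{\alpha e^{\delta\alpha}}{\pi\sqrt{1+x^2\delta^{-2}}}\,K_1\big(\delta\alpha(1+x^2\delta^{-2})^{1/2}\big),\quad x\in\mathbb R,\qquad K_1(z)=\tfrac12\int_0^\infty e^{-z(y+y^{-1})/2}\,dy,\quad z>0.$$ $Y$ is called deterministic if every $Y_t$ is almost surely constant, and $Y$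 has no Gaussian component if the Gaussian variance in its Lévy–Khintchine triplet is $0$. Then: 1. If $Y_1$ has an $\mathrm{IG}(\mu,\lambda)$-distribution for some $\mu,\lambda>0$, then for $q\in(0,\infty]$, $\mathcal H$ satisfies $C_q$ if and only if $q\in(0,\tfrac12)$. 2. If $Y_1$ has an $\mathrm{NIG}(\alpha,0,0,\delta)$-distribution for some $\alpha,\delta>0$, then for $q\in(0,\infty]$, $\mathcal H$ satisfies $C_q$ if and only if $q\in(0,1)$. 3. If $Y$ is non-deterministic and has no Gaussian component, then $\mathcal H$ does not satisfy $C_q$ for any $q\in[2,\infty]$. In fact, if in addition $Y$ is square-integrable (that is, $E[Y_t^2]<\infty$ for all $t$), then $\lim_{t\downarrow0}\|Y_t\|_2/\|Y_t\|_1=\infty$. -/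

import Mathlib

open MeasureTheory ProbabilityTheory Filter Topology
open scoped ENNReal

namespace LevyChaos

noncomputable section

/-! ### Condition `C_q` for a collection `𝓗 = {𝓗_ξ : ξ ∈ I}` of families of random variables -/

/-- Condition `C_q` for `q ∈ (0, ∞)`. The truncated moment `E[|Z|^q, |Z| > s]` is the Lebesgue
integral of a nonnegative function, with value in `[0, ∞]`. -/
def SatisfiesCFinite {Ω I : Type*} [MeasurableSpace Ω] (P : Measure Ω)
    (𝓗 : I → Set (Ω → ℝ)) (q : ℝ) : Prop :=
  ∃ β₁ β₂ : ℝ, 0 < β₁ ∧ 0 < β₂ ∧ ∀ ξ, ∀ Z ∈ 𝓗 ξ, ∃ c : ℝ, 0 < c ∧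
    ENNReal.ofReal β₁ ≤ P {ω | c ≤ |Z ω|} ∧
    ∀ s : ℝ, c ≤ s →
      ∫⁻ ω in {ω | s < |Z ω|}, ENNReal.ofReal (|Z ω| ^ q) ∂P
        ≤ ENNReal.ofReal (β₂ * s ^ q) * P {ω | s < |Z ω|}

/-- Condition `C_∞`: every `Z` is integrable and the quotients `‖Z - E Z‖_∞ / ‖Z - E Z‖_2` are
bounded by a finite constant. A quotient with infinite numerator is not bounded (also when the
denominator is infinite), and `0 / 0` counts as `0`. -/
def SatisfiesCTop {Ω I : Type*} [MeasurableSpace Ω] (P : Measure Ω)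
    (𝓗 : I → Set (Ω → ℝ)) : Prop :=
  (∀ ξ, ∀ Z ∈ 𝓗 ξ, MemLp Z 1 P) ∧
  ∃ β₃ : ℝ, ∀ ξ, ∀ Z ∈ 𝓗 ξ,
    eLpNorm (fun ω => Z ω - ∫ ω', Z ω' ∂P) ∞ P ≠ ∞ ∧
    eLpNorm (fun ω => Z ω - ∫ ω', Z ω' ∂P) ∞ P
      ≤ ENNReal.ofReal β₃ * eLpNorm (fun ω => Z ω - ∫ ω', Z ω' ∂P) 2 P

/-- Condition `C_q` for `q ∈ (0, ∞]`. -/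
def SatisfiesC {Ω I : Type*} [MeasurableSpace Ω] (P : Measure Ω)
    (𝓗 : I → Set (Ω → ℝ)) (q : ℝ≥0∞) : Prop :=
  (q = ∞ → SatisfiesCTop P 𝓗) ∧ (q ≠ ∞ → SatisfiesCFinite P 𝓗 q.toReal)

/-! ### Lévy processes on `[0, t₀]` -/

/-- `Y = (Y_t)_{t ∈ [0, t₀]}` is a real Lévy process. -/
structure IsLevyProcess {Ω : Type*} [MeasurableSpace Ω] (P : Measure Ω) {t₀ : ℝ}
    (Y : Set.Icc (0 : ℝ) t₀ → Ω → ℝ) : Prop where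
  measurable : ∀ t, Measurable (Y t)
  zero : ∀ t : Set.Icc (0 : ℝ) t₀, (t : ℝ) = 0 → ∀ᵐ ω ∂P, Y t ω = 0
  indep : HasIndepIncrements Y P
  stationary : ∀ s t s' t' : Set.Icc (0 : ℝ) t₀, s ≤ t → s' ≤ t' →
    (t : ℝ) - s = (t' : ℝ) - s' →
    P.map (fun ω => Y t ω - Y s ω) = P.map (fun ω => Y t' ω - Y s' ω)
  stochasticallyContinuous : ∀ t, TendstoInMeasure P Y (𝓝 t) (Y t)
  cadlag : ∀ᵐ ω ∂P, ∀ t, ContinuousWithinAt (fun r => Y r ω) (Set.Ici t) t ∧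
    ∃ l : ℝ, Tendsto (fun r => Y r ω) (𝓝[<] t) (𝓝 l)

/-- Every `Y_t` is almost surely constant. -/
def IsDeterministic {Ω : Type*} [MeasurableSpace Ω] (P : Measure Ω) {t₀ : ℝ}
    (Y : Set.Icc (0 : ℝ) t₀ → Ω → ℝ) : Prop :=
  ∀ t, ∃ c : ℝ, ∀ᵐ ω ∂P, Y t ω = c

/-- `ν` is a Lévy measure on `ℝ`. -/
def IsLevyMeasure (ν : Measure ℝ) : Prop :=
  ν {0} = 0 ∧ ∫⁻ x, ENNReal.ofReal (min 1 (x ^ 2)) ∂ν < ∞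

/-- The Lévy–Khintchine exponent of the triplet `(b, v, ν)`, `v` being the Gaussian variance. -/
def levyExponent (b v : ℝ) (ν : Measure ℝ) (u : ℝ) : ℂ :=
  Complex.I * b * u - v * u ^ 2 / 2 +
    ∫ x : ℝ, (Complex.exp (Complex.I * u * x) - 1
      - if |x| ≤ 1 then Complex.I * u * x else 0) ∂ν

/-- `(b, v, ν)` is the characteristic triplet of the Lévy process `Y`. -/
def HasLevyTriplet {Ω : Type*} [MeasurableSpace Ω] (P : Measure Ω) {t₀ : ℝ}
    (Y : Set.Icc (0 : ℝ) t₀ → Ω → ℝ) (b v : ℝ) (ν : Measure ℝ) : Prop :=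
  0 ≤ v ∧ IsLevyMeasure ν ∧
    ∀ (t : Set.Icc (0 : ℝ) t₀) (u : ℝ),
      charFun (P.map (Y t)) u = Complex.exp ((t : ℝ) * levyExponent b v ν u)

/-- The Gaussian variance in the characteristic triplet of `Y` is zero. -/
def HasNoGaussianComponent {Ω : Type*} [MeasurableSpace Ω] (P : Measure Ω) {t₀ : ℝ}
    (Y : Set.Icc (0 : ℝ) t₀ → Ω → ℝ) : Prop :=
  ∃ (b : ℝ) (ν : Measure ℝ), HasLevyTriplet P Y b 0 ν

/-! ### The random measure `Λ(A) = ∫_A dY_s` and the associated collection `𝓗` -/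

/-- A finite union of successive intervals `(a_i, b_i]` in `[0, t₀]`. -/
structure ElementarySet (t₀ : ℝ) where
  n : ℕ
  left : Fin n → Set.Icc (0 : ℝ) t₀
  right : Fin n → Set.Icc (0 : ℝ) t₀
  left_le_right : ∀ i, left i ≤ right i
  ordered : ∀ i j, i < j → right i ≤ left j

/-- The subset `⋃ i, (a_i, b_i]` of the real line. -/
def ElementarySet.carrier {t₀ : ℝ} (E : ElementarySet t₀) : Set ℝ :=
  ⋃ i, Set.Ioc (E.left i : ℝ) (E.right i : ℝ)

/-- The elementary integral `∑ i, (Y_{b_i} - Y_{a_i})`. -/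
def ElementarySet.integral {Ω : Type*} {t₀ : ℝ} (E : ElementarySet t₀)
    (Y : Set.Icc (0 : ℝ) t₀ → Ω → ℝ) : Ω → ℝ :=
  fun ω => ∑ i, (Y (E.right i) ω - Y (E.left i) ω)

/-- `Z = ∫_A dY_s`: the random variable `Z` is the limit in probability of the elementary
integrals of elementary sets that approximate `A` in Lebesgue measure. For a Lévy process `Y`
and Borel `A ⊆ [0, t₀]` such a `Z` exists and is almost surely unique. -/
def IsIntegralOver {Ω : Type*} [MeasurableSpace Ω] (P : Measure Ω) {t₀ : ℝ}
    (Y : Set.Icc (0 : ℝ) t₀ → Ω → ℝ) (A : Set ℝ) (Z : Ω → ℝ) : Prop :=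
  Measurable Z ∧ ∃ E : ℕ → ElementarySet t₀,
    Tendsto (fun k => volume (symmDiff (E k).carrier A)) atTop (𝓝 0) ∧
    TendstoInMeasure P (fun k => (E k).integral Y) atTop Z

/-- `Λ` is the random measure on the Borel subsets of `[0, t₀]` induced by `Y`. -/
def IsInducedRandomMeasure {Ω : Type*} [MeasurableSpace Ω] (P : Measure Ω) {t₀ : ℝ}
    (Y : Set.Icc (0 : ℝ) t₀ → Ω → ℝ) (Λ : Set ℝ → Ω → ℝ) : Prop :=
  ∀ A : Set ℝ, MeasurableSet A → A ⊆ Set.Icc 0 t₀ → IsIntegralOver P Y A (Λ A)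

/-- The index set `I`: non-empty finite collections `ξ = {A_1, …, A_n}` of disjoint Borel subsets
of `[0, t₀]` of positive Lebesgue measure. -/
def borelFamilies (t₀ : ℝ) : Set (Set (Set ℝ)) :=
  {ξ | ξ.Finite ∧ ξ.Nonempty ∧ ξ.PairwiseDisjoint id ∧
    ∀ A ∈ ξ, MeasurableSet A ∧ A ⊆ Set.Icc 0 t₀ ∧ 0 < volume A}

/-- The collection `𝓗 = {𝓗_ξ : ξ ∈ I}` with `𝓗_ξ = {Λ(A_1), …, Λ(A_n)}`. -/
def inducedFamily {Ω : Type*} (t₀ : ℝ) (Λ : Set ℝ → Ω → ℝ) :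
    borelFamilies t₀ → Set (Ω → ℝ) :=
  fun ξ => Λ '' (ξ : Set (Set ℝ))

/-! ### Inverse Gaussian and symmetric normal inverse Gaussian distributions -/

/-- The inverse Gaussian distribution `IG(μ, l)`, for `μ, l > 0`. -/
def inverseGaussian (μ l : ℝ) : Measure ℝ :=
  (volume.restrict (Set.Ioi 0)).withDensity fun x =>
    ENNReal.ofReal (Real.sqrt (l / (2 * Real.pi * x ^ 3)) *
      Real.exp (-l * (x - μ) ^ 2 / (2 * μ ^ 2 * x)))

/-- The modified Bessel function `K₁(z)`, for `z > 0`. -/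
def besselK1 (z : ℝ) : ℝ :=
  (1 / 2) * ∫ y in Set.Ioi (0 : ℝ), Real.exp (-z * (y + y⁻¹) / 2)

/-- The symmetric normal inverse Gaussian distribution `NIG(α, 0, 0, δ)`, for `α, δ > 0`. -/
def symmetricNIG (α δ : ℝ) : Measure ℝ :=
  volume.withDensity fun x =>
    ENNReal.ofReal (α * Real.exp (δ * α) / (Real.pi * Real.sqrt (1 + x ^ 2 / δ ^ 2)) *
      besselK1 (δ * α * Real.sqrt (1 + x ^ 2 / δ ^ 2)))

end

end LevyChaos

/-! The first step replaces random variables by laws. The integral of `Y` over `A` is a limit in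
probability of sums of independent increments, so its law is that of `Y_t` with `t` the Lebesgue
measure of `A` (`IsLevyProcess.map_eq_of_isIntegralOver`). Hence the laws occurring in the
collection are exactly those of `Y_t` with `0 < t ≤ t₀`, and each claim is about this one-parameter
family, uniformly as `t` tends to zero.

For the inverse Gaussian and NIG cases the marginals are again of the same type. Exponential moments
are multiplicative in time, hence of the form `exp (t ψ)`; near zero they determine a law, by
analytic continuation to the imaginary axis (`ext_of_expMoment`). This gives `IG(tμ, t²λ)` and
`NIG(α, 0, 0, tδ)`. At small `t` both densities look like a pure power `x ^ (-κ - 1)` from a scale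
`r` up to a fixed cutoff, with `κ = 1/2`, `r = t²` and `κ = 1`, `r = t` respectively. `HasPowerTail`
records this with constants independent of `t`; the ratio `N = 2 t₀ / t` of cutoff to scale is
unbounded as `t` decreases. For `q < κ` the truncated moment of order `q` converges at infinity and
is comparable to `s ^ q` times the tail probability, uniformly in `t`. For `q = κ` it exceeds the
permitted size by a factor of order `log N`, so `C_κ` fails, and then so does `C_q` for every finite
`q ≥ κ`. Unbounded support excludes `C_∞`. This is `satisfiesC_iff_of_hasPowerTail`.

For the third claim, `C_2` and `C_∞` both imply a reverse Hölder inequality `‖Z‖₂ ≤ κ ‖Z‖₁`. Without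
Gaussian part the exponent is `o(u²)` at infinity, so `Y_t / √t` tends to zero in probability,
whereas nondeterminism keeps `E[Y_t²]` at least of order `t`. Thus almost all of the second moment
sits on an event of vanishing probability, and Cauchy–Schwarz gives `‖Y_t‖₁ = o(‖Y_t‖₂)`
(`eventually_integral_abs_le`), which contradicts the reverse inequality. -/

namespace LevyChaos

/-! ### Laws of the increments of a Lévy process -/

/-- The law of `Y_t`, with `t` clamped to `[0, t₀]`. -/
noncomputable def levyLaw {Ω : Type*} [MeasurableSpace Ω] (P : Measure Ω) {t₀ : ℝ} (h₀ : 0 ≤ t₀)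
    (Y : Set.Icc (0 : ℝ) t₀ → Ω → ℝ) (t : ℝ) : Measure ℝ :=
  P.map (Y (Set.projIcc 0 t₀ h₀ t))

section Law

variable {Ω : Type*} [MeasurableSpace Ω] {P : Measure Ω} {t₀ : ℝ} {h₀ : 0 ≤ t₀}
  {Y : Set.Icc (0 : ℝ) t₀ → Ω → ℝ}

lemma levyLaw_coe (t : Set.Icc (0 : ℝ) t₀) : levyLaw P h₀ Y t = P.map (Y t) := by
  rw [levyLaw, Set.projIcc_val]

lemma IsLevyProcess.isProbabilityMeasure_levyLaw [IsProbabilityMeasure P]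
    (hY : IsLevyProcess P Y) (t : ℝ) : IsProbabilityMeasure (levyLaw P h₀ Y t) :=
  Measure.isProbabilityMeasure_map (hY.measurable _).aemeasurable

lemma IsLevyProcess.map_sub (hY : IsLevyProcess P Y) {s t : Set.Icc (0 : ℝ) t₀} (hst : s ≤ t) :
    P.map (fun ω => Y t ω - Y s ω) = levyLaw P h₀ Y (t - s) := by
  have hst' : (s : ℝ) ≤ t := hst
  have hmem : (t : ℝ) - s ∈ Set.Icc (0 : ℝ) t₀ :=
    ⟨sub_nonneg.2 hst', by linarith [t.2.2, s.2.1]⟩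
  have h := hY.stationary s t ⟨0, Set.left_mem_Icc.2 h₀⟩ ⟨(t : ℝ) - s, hmem⟩ hst hmem.1 (by simp)
  have h1 : levyLaw P h₀ Y (t - s) = P.map (Y ⟨(t : ℝ) - s, hmem⟩) := levyLaw_coe ⟨_, hmem⟩
  rw [h, h1]
  refine Measure.map_congr ?_
  filter_upwards [hY.zero ⟨0, Set.left_mem_Icc.2 h₀⟩ rfl] with ω hω
  simp [hω]

/-- `Y_{s+t}` is the sum of `Y_s`, which is the increment from time zero, and of an independent
increment of length `t`. -/
lemma IsLevyProcess.levyLaw_add [IsProbabilityMeasure P] (hY : IsLevyProcess P Y) {s t : ℝ}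
    (hs : 0 ≤ s) (ht : 0 ≤ t) (hst : s + t ≤ t₀) :
    levyLaw P h₀ Y (s + t) = (levyLaw P h₀ Y s).conv (levyLaw P h₀ Y t) := by
  let s' : Set.Icc (0 : ℝ) t₀ := ⟨s, hs, by linarith⟩
  let r' : Set.Icc (0 : ℝ) t₀ := ⟨s + t, by linarith, hst⟩
  have hsr : s' ≤ r' := by
    change s ≤ s + t
    linarith
  have h0 := hY.zero ⟨0, Set.left_mem_Icc.2 h₀⟩ rfl
  have hind := hY.indep.indepFun_eval_sub (r := ⟨0, Set.left_mem_Icc.2 h₀⟩) (s := s') (t := r') hs hsr h0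
  have hadd := hind.map_add_eq_map_conv_map₀ (hY.measurable _).aemeasurable
    ((hY.measurable r').sub (hY.measurable s')).aemeasurable
  have h1 : Y s' + (Y r' - Y s') = Y r' := by
    ext ω
    simp
  have h2 : P.map (Y r' - Y s') = levyLaw P h₀ Y t := by
    have h3 := hY.map_sub (h₀ := h₀) hsr
    simp only [s', r', add_sub_cancel_left] at h3
    exact h3
  rw [h1, h2] at hadd
  rw [← levyLaw_coe (h₀ := h₀) r', ← levyLaw_coe (h₀ := h₀) s'] at hadd
  exact hadd

lemma IsLevyProcess.charFun_levyLaw_zero [IsProbabilityMeasure P] (hY : IsLevyProcess P Y)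
    (u : ℝ) : charFun (levyLaw P h₀ Y 0) u = 1 := by
  have h : P.map (Y ⟨0, Set.left_mem_Icc.2 h₀⟩) = Measure.dirac 0 := by
    have h1 : P.map (Y ⟨0, Set.left_mem_Icc.2 h₀⟩) = P.map (fun _ => (0 : ℝ)) :=
      Measure.map_congr (hY.zero ⟨0, Set.left_mem_Icc.2 h₀⟩ rfl)
    rw [h1]
    simp
  have h2 : levyLaw P h₀ Y 0 = Measure.dirac 0 := by
    rw [← h, ← levyLaw_coe (h₀ := h₀)]
  rw [h2]
  simp

/-- Iterates the semigroup property over the interval lengths of an elementary set. The total must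
stay below `t₀`, since the clamped law is constant in time beyond `t₀`. -/
lemma IsLevyProcess.prod_charFun_levyLaw [IsProbabilityMeasure P] (hY : IsLevyProcess P Y)
    {ι : Type*} (S : Finset ι) (f : ι → ℝ) (hf : ∀ i ∈ S, 0 ≤ f i) (hS : ∑ i ∈ S, f i ≤ t₀)
    (u : ℝ) :
    ∏ i ∈ S, charFun (levyLaw P h₀ Y (f i)) u = charFun (levyLaw P h₀ Y (∑ i ∈ S, f i)) u := by
  classical
  induction S using Finset.induction_on with
  | empty => simp [hY.charFun_levyLaw_zero]
  | insert a S ha ih =>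
    rw [Finset.sum_insert ha] at hS
    have h1 : 0 ≤ f a := hf a (Finset.mem_insert_self _ _)
    have h2 : ∀ i ∈ S, 0 ≤ f i := fun i hi => hf i (Finset.mem_insert_of_mem hi)
    have h3 : 0 ≤ ∑ i ∈ S, f i := Finset.sum_nonneg h2
    have : IsProbabilityMeasure (levyLaw P h₀ Y (f a)) := hY.isProbabilityMeasure_levyLaw _
    have : IsProbabilityMeasure (levyLaw P h₀ Y (∑ i ∈ S, f i)) :=
      hY.isProbabilityMeasure_levyLaw _
    rw [Finset.prod_insert ha, Finset.sum_insert ha, ih h2 (by linarith),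
      hY.levyLaw_add h1 h3 hS, charFun_conv]

end Law

/-! ### Elementary sets -/

section Elementary

variable {t₀ : ℝ}

/-- The total length of the intervals of an elementary set. -/
def ElementarySet.length (E : ElementarySet t₀) : ℝ := ∑ i, ((E.right i : ℝ) - E.left i)

/-- The endpoints `a_0 ≤ b_0 ≤ a_1 ≤ b_1 ≤ …` of an elementary set in increasing order. -/
noncomputable def ElementarySet.endpoint (E : ElementarySet t₀) (h : 0 < E.n) (k : ℕ) :
    Set.Icc (0 : ℝ) t₀ :=
  if hk : k / 2 < E.n then (if k % 2 = 0 then E.left ⟨k / 2, hk⟩ else E.right ⟨k / 2, hk⟩)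
  else E.right ⟨E.n - 1, by omega⟩

/-- Monotonicity makes the sequence admissible for the independence of increments along a sequence
of times. Past the last interval it is frozen at the last right endpoint, so that it is defined for
every index. -/
lemma ElementarySet.monotone_endpoint (E : ElementarySet t₀) (h : 0 < E.n) :
    Monotone (E.endpoint h) := by
  refine monotone_nat_of_le_succ fun k => ?_
  unfold ElementarySet.endpoint
  rcases Nat.even_or_odd' k with ⟨m, rfl | rfl⟩
  · have h1 : 2 * m / 2 = m := by omega
    have h2 : (2 * m + 1) / 2 = m := by omega
    have h3 : 2 * m % 2 = 0 := by omega
    have h4 : (2 * m + 1) % 2 = 1 := by omega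
    simp only [h1, h2, h3, h4]
    by_cases hm : m < E.n
    · simpa [hm] using E.left_le_right _
    · simp [hm]
  · have h1 : (2 * m + 1) / 2 = m := by omega
    have h2 : (2 * m + 1 + 1) / 2 = m + 1 := by omega
    have h3 : (2 * m + 1 + 1) % 2 = 0 := by omega
    have h4 : (2 * m + 1) % 2 = 1 := by omega
    simp only [h1, h2, h3, h4]
    by_cases hm : m + 1 < E.n
    · have hm' : m < E.n := by omega
      simp only [hm, hm', dite_true]
      exact E.ordered _ _ (by simp [Fin.lt_def])
    · by_cases hm' : m < E.n
      · have hmn : m = E.n - 1 := by omega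
        subst hmn
        simp [hm']
        grind
      · simp [hm, hm']

lemma ElementarySet.volume_carrier (E : ElementarySet t₀) :
    volume E.carrier = ENNReal.ofReal E.length := by
  unfold ElementarySet.carrier ElementarySet.length
  rw [measure_iUnion]
  · simp only [Real.volume_Ioc, tsum_fintype]
    rw [ENNReal.ofReal_sum_of_nonneg]
    intro i _
    exact sub_nonneg.2 (E.left_le_right i)
  · have key : ∀ i j, i < j → Disjoint (Set.Ioc (E.left i : ℝ) (E.right i))
        (Set.Ioc (E.left j : ℝ) (E.right j)) := by
      intro i j hij
      rw [Set.disjoint_left]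
      intro x hx hx'
      have : (E.right i : ℝ) ≤ E.left j := E.ordered i j hij
      linarith [hx.2, hx'.1]
    intro i j hij
    rcases lt_or_gt_of_ne hij with h | h
    · exact key i j h
    · exact (key j i h).symm
  · intro i
    exact measurableSet_Ioc

lemma ElementarySet.carrier_subset (E : ElementarySet t₀) : E.carrier ⊆ Set.Icc 0 t₀ := by
  unfold ElementarySet.carrier
  refine Set.iUnion_subset fun i x hx => ⟨?_, ?_⟩
  · linarith [hx.1, (E.left i).2.1]
  · linarith [hx.2, (E.right i).2.2]

lemma ElementarySet.length_nonneg (E : ElementarySet t₀) : 0 ≤ E.length :=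
  Finset.sum_nonneg fun i _ => sub_nonneg.2 (E.left_le_right i)

lemma ElementarySet.measureReal_carrier (E : ElementarySet t₀) :
    volume.real E.carrier = E.length := by
  rw [Measure.real, E.volume_carrier, ENNReal.toReal_ofReal E.length_nonneg]

lemma ElementarySet.length_le (E : ElementarySet t₀) (h₀ : 0 ≤ t₀) : E.length ≤ t₀ := by
  rw [← E.measureReal_carrier]
  refine (measureReal_mono E.carrier_subset ?_).trans ?_
  · simp
  · simp [h₀]

variable {Ω : Type*} [MeasurableSpace Ω] {P : Measure Ω} [IsProbabilityMeasure P] {h₀ : 0 ≤ t₀}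
  {Y : Set.Icc (0 : ℝ) t₀ → Ω → ℝ}

/-- Along the endpoint sequence, the increments at even indices run over the intervals and those at
odd indices over the gaps. A subfamily of an independent family is independent, so the gaps can be
dropped. -/
lemma IsLevyProcess.iIndepFun_increments (hY : IsLevyProcess P Y) (E : ElementarySet t₀) :
    iIndepFun (fun i ω => Y (E.right i) ω - Y (E.left i) ω) P := by
  rcases Nat.eq_zero_or_pos E.n with h | h
  · have : IsEmpty (Fin E.n) := by
      rw [h]
      infer_instance
    exact iIndepFun.of_subsingleton
  · have h1 := (hY.indep.nat (E.monotone_endpoint h)).precomp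
      (g := fun i : Fin E.n => 2 * (i : ℕ)) (fun i j hij => by
        have : 2 * (i : ℕ) = 2 * (j : ℕ) := hij
        exact Fin.ext (by omega))
    convert h1 using 2 with i ω
    have h2 : (2 * (i : ℕ)) / 2 = i := by omega
    have h3 : (2 * (i : ℕ) + 1) / 2 = i := by omega
    have h4 : (2 * (i : ℕ) + 1) % 2 = 1 := by omega
    simp [ElementarySet.endpoint, h2, h3, h4]

lemma IsLevyProcess.charFun_map_integral (hY : IsLevyProcess P Y) (E : ElementarySet t₀) (u : ℝ) :
    charFun (P.map (E.integral Y)) u = charFun (levyLaw P h₀ Y E.length) u := by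
  have h1 : E.integral Y = ∑ i, fun ω => Y (E.right i) ω - Y (E.left i) ω := by
    ext ω
    simp [ElementarySet.integral]
  have h2 := (hY.iIndepFun_increments E).charFun_map_sum_eq_prod
    (fun i => Measurable.aemeasurable (by have := hY.measurable; fun_prop))
  rw [h1, h2, Finset.prod_apply, ElementarySet.length, ← hY.prod_charFun_levyLaw]
  · refine Finset.prod_congr rfl fun i _ => ?_
    rw [hY.map_sub (h₀ := h₀) (E.left_le_right i)]
  · exact fun i _ => sub_nonneg.2 (E.left_le_right i)
  · exact E.length_le h₀

lemma tendsto_charFun_of_tendstoInMeasure {f : ℕ → Ω → ℝ} {g : Ω → ℝ}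
    (hf : ∀ n, AEMeasurable (f n) P) (h : TendstoInMeasure P f atTop g) (u : ℝ) :
    Tendsto (fun n => charFun (P.map (f n)) u) atTop (𝓝 (charFun (P.map g) u)) := by
  have h1 := h.tendstoInDistribution hf
  exact ProbabilityMeasure.tendsto_iff_tendsto_charFun.1 h1.tendsto u

/-- The random variable `∫_A dY_s` has the same law as `Y_t` with `t` the Lebesgue measure
of `A`. -/
theorem IsLevyProcess.map_eq_of_isIntegralOver (hY : IsLevyProcess P Y) {A : Set ℝ} {Z : Ω → ℝ}
    (hA : MeasurableSet A) (hA' : A ⊆ Set.Icc 0 t₀) (hZ : IsIntegralOver P Y A Z) :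
    P.map Z = levyLaw P h₀ Y (volume.real A) := by
  obtain ⟨hZm, E, hE, hEZ⟩ := hZ
  have : IsProbabilityMeasure (P.map Z) := Measure.isProbabilityMeasure_map hZm.aemeasurable
  have : IsProbabilityMeasure (levyLaw P h₀ Y (volume.real A)) :=
    hY.isProbabilityMeasure_levyLaw _
  have hAfin : volume A ≠ ∞ := ((measure_mono hA').trans_lt (by simp)).ne
  have hlen : Tendsto (fun k => (E k).length) atTop (𝓝 (volume.real A)) := by
    rw [tendsto_iff_dist_tendsto_zero]
    have h1 : Tendsto (fun k => volume.real (symmDiff (E k).carrier A)) atTop (𝓝 0) := by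
      have := (ENNReal.tendsto_toReal ENNReal.zero_ne_top).comp hE
      simpa [Function.comp_def, Measure.real] using this
    refine squeeze_zero (fun _ => dist_nonneg) (fun k => ?_) h1
    rw [Real.dist_eq, ← (E k).measureReal_carrier]
    refine abs_measureReal_sub_le_measureReal_symmDiff' ?_ ?_ ?_ ?_
    · exact (MeasurableSet.iUnion fun i => measurableSet_Ioc).nullMeasurableSet
    · exact hA.nullMeasurableSet
    · rw [(E k).volume_carrier]
      simp
    · exact hAfin
  have ht : volume.real A ∈ Set.Icc 0 t₀ := by
    refine ⟨measureReal_nonneg, le_of_tendsto hlen (Eventually.of_forall fun k => ?_)⟩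
    exact (E k).length_le h₀
  -- The characteristic functions of the elementary integrals have two limits: that of `Z`, by
  -- convergence in probability, and that of the law at time `volume.real A`, by stochastic
  -- continuity along the converging lengths.
  refine Measure.ext_of_charFun (funext fun u => ?_)
  have h1 := tendsto_charFun_of_tendstoInMeasure (f := fun k => (E k).integral Y) (fun k => by
    unfold ElementarySet.integral
    exact (Finset.measurable_sum _ fun i _ =>
      (hY.measurable _).sub (hY.measurable _)).aemeasurable) hEZ u
  simp_rw [hY.charFun_map_integral (h₀ := h₀)] at h1
  refine tendsto_nhds_unique h1 ?_
  have h2 : Tendsto (fun k => (⟨(E k).length, (E k).length_nonneg, (E k).length_le h₀⟩ :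
      Set.Icc (0 : ℝ) t₀)) atTop (𝓝 ⟨volume.real A, ht⟩) :=
    tendsto_subtype_rng.2 hlen
  have h3 := (hY.stochasticallyContinuous ⟨volume.real A, ht⟩).comp h2
  have h4 := tendsto_charFun_of_tendstoInMeasure (fun k => (hY.measurable _).aemeasurable) h3 u
  simp_rw [← levyLaw_coe (h₀ := h₀)] at h4
  exact h4

end Elementary

/-! ### Exponential moments along a Lévy process -/

/-- The exponential moment `∫ e^{ux} m(dx)`, with value in `[0, ∞]`. -/
noncomputable def expMoment (m : Measure ℝ) (u : ℝ) : ℝ≥0∞ :=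
  ∫⁻ x, ENNReal.ofReal (Real.exp (u * x)) ∂m

lemma expMoment_conv (m m' : Measure ℝ) [SFinite m] [SFinite m'] (u : ℝ) :
    expMoment (m.conv m') u = expMoment m u * expMoment m' u := by
  unfold expMoment
  rw [Measure.lintegral_conv (by fun_prop)]
  simp_rw [mul_add, Real.exp_add, ENNReal.ofReal_mul (Real.exp_pos _).le]
  simp_rw [lintegral_const_mul _ (show Measurable fun y : ℝ => ENNReal.ofReal (Real.exp (u * y))
    by fun_prop)]
  rw [lintegral_mul_const _ (by fun_prop)]

/-- A multiplicative function on `(0, t₀]` with a lower semicontinuity property is determined by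
its value at `1`. -/
lemma eq_exp_of_multiplicative {t₀ : ℝ} (ht₀ : 1 ≤ t₀) {G : ℝ → ℝ≥0∞} {ψ : ℝ}
    (hadd : ∀ s t, 0 ≤ s → 0 ≤ t → s + t ≤ t₀ → G (s + t) = G s * G t)
    (hlsc : ∀ t ∈ Set.Icc 0 t₀, ∀ r : ℕ → ℝ, (∀ n, r n ∈ Set.Icc 0 t₀) → Tendsto r atTop (𝓝 t) →
      (∀ n, G (r n) = ENNReal.ofReal (Real.exp (r n * ψ))) → G t ≤ ENNReal.ofReal (Real.exp (t * ψ)))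
    (h1 : G 1 = ENNReal.ofReal (Real.exp ψ)) {t : ℝ} (ht : 0 < t) (ht' : t ≤ t₀) :
    G t = ENNReal.ofReal (Real.exp (t * ψ)) := by
  have hmul : ∀ s : ℝ, 0 ≤ s → ∀ k : ℕ, ((k : ℝ) + 1) * s ≤ t₀ →
      G (((k : ℝ) + 1) * s) = G s ^ (k + 1) := by
    intro s hs k
    induction k with
    | zero => simp
    | succ k ih =>
      intro hk
      push_cast at hk ⊢
      have h2 : ((k : ℝ) + 1 + 1) * s = (k + 1) * s + s := by ring
      rw [h2] at hk ⊢
      rw [hadd _ _ (by positivity) hs hk, ih (by linarith), pow_succ (G s) (k + 1)]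
  have hexp : ∀ (x : ℝ) (k : ℕ), ENNReal.ofReal (Real.exp ((k : ℝ) * x))
      = ENNReal.ofReal (Real.exp x) ^ k := by
    intro x k
    rw [Real.exp_nat_mul, ENNReal.ofReal_pow (Real.exp_pos _).le]
  have hinv : ∀ n : ℕ, G (1 / ((n : ℝ) + 1)) = ENNReal.ofReal (Real.exp (1 / ((n : ℝ) + 1) * ψ)) := by
    intro n
    have hn : (0 : ℝ) < (n : ℝ) + 1 := by positivity
    have h2 := hmul (1 / ((n : ℝ) + 1)) (by positivity) n (by field_simp; exact ht₀)
    have h3 : ((n : ℝ) + 1) * (1 / ((n : ℝ) + 1)) = 1 := by field_simp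
    rw [h3, h1] at h2
    have h4 := hexp (1 / ((n : ℝ) + 1) * ψ) (n + 1)
    push_cast at h4
    rw [← mul_assoc, h3, one_mul, h2] at h4
    exact (ENNReal.pow_right_strictMono (n := n + 1) (by omega)).injective h4
  have hrat : ∀ r : ℚ, 0 < r → (r : ℝ) ≤ t₀ → G r = ENNReal.ofReal (Real.exp (r * ψ)) := by
    intro r hr hrt
    obtain ⟨n, hn⟩ : ∃ n, r.den = n + 1 := Nat.exists_eq_succ_of_ne_zero r.den_nz
    obtain ⟨k, hk⟩ : ∃ k : ℕ, r.num = k + 1 := by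
      refine ⟨(r.num - 1).toNat, ?_⟩
      have := Rat.num_pos.2 hr
      omega
    have hrr : (r : ℝ) = ((k : ℝ) + 1) * (1 / ((n : ℝ) + 1)) := by
      rw [Rat.cast_def, hn, hk]
      push_cast
      ring
    rw [hrr] at hrt ⊢
    rw [hmul _ (by positivity) k hrt, hinv]
    have h4 := hexp (1 / ((n : ℝ) + 1) * ψ) (k + 1)
    push_cast at h4
    rw [mul_assoc, h4]
  -- Semicontinuity along rationals yields only one inequality at irrational times; multiplicativity
  -- supplies the other one below.
  have hle : ∀ s : ℝ, 0 < s → s ≤ t₀ → G s ≤ ENNReal.ofReal (Real.exp (s * ψ)) := by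
    intro s hs hst
    have hex : ∀ n : ℕ, ∃ r : ℚ, max 0 (s - 1 / ((n : ℝ) + 1)) < r ∧ (r : ℝ) < s := fun n =>
      exists_rat_btwn (max_lt hs (by
        have : 0 < 1 / ((n : ℝ) + 1) := by positivity
        linarith))
    choose r hr1 hr2 using hex
    have hr0 : ∀ n, (0 : ℝ) < r n := fun n => (le_max_left _ _).trans_lt (hr1 n)
    refine hlsc s ⟨hs.le, hst⟩ (fun n => r n) (fun n => ⟨(hr0 n).le, (hr2 n).le.trans hst⟩) ?_
      (fun n => hrat _ (by exact_mod_cast hr0 n) ((hr2 n).le.trans hst))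
    refine tendsto_of_tendsto_of_tendsto_of_le_of_le (g := fun n : ℕ => s - 1 / ((n : ℝ) + 1))
      (h := fun _ => s) ?_ tendsto_const_nhds
      (fun n => ((le_max_right _ _).trans_lt (hr1 n)).le) (fun n => (hr2 n).le)
    simpa using tendsto_const_nhds.sub (tendsto_one_div_add_atTop_nhds_zero_nat (𝕜 := ℝ))
  -- Complete `s` to a rational `r` by adding `r - s`. Both factors of `G r = G s * G (r - s)` obey
  -- the upper bound, so a strict inequality at `s` would make the value at `r` too small.
  have hlt : ∀ s : ℝ, 0 < s → s < t₀ → G s = ENNReal.ofReal (Real.exp (s * ψ)) := by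
    intro s hs hst
    obtain ⟨r, hr1, hr2⟩ := exists_rat_btwn hst
    have hr := hrat r (by exact_mod_cast hs.trans hr1) hr2.le
    have hadd' := hadd s (r - s) hs.le (by linarith) (by linarith)
    rw [add_sub_cancel, hr] at hadd'
    refine le_antisymm (hle s hs hst.le) ?_
    by_contra hcon
    push Not at hcon
    have h5 : G s * G (r - s) < ENNReal.ofReal (Real.exp (s * ψ)) *
        ENNReal.ofReal (Real.exp ((r - s) * ψ)) := by
      refine (mul_le_mul_right (hle (r - s) (by linarith) (by linarith)) (G s)).trans_lt ?_
      exact ENNReal.mul_lt_mul_left (by simp [Real.exp_pos]) ENNReal.ofReal_ne_top hcon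
    rw [← hadd', ← ENNReal.ofReal_mul (Real.exp_pos _).le, ← Real.exp_add, ← add_mul,
      add_sub_cancel] at h5
    exact lt_irrefl _ h5
  rcases ht'.lt_or_eq with h | h
  · exact hlt t ht h
  -- At the right endpoint there is no rational time above `t`, so the value comes from two halves.
  · have h2 := hadd (t / 2) (t / 2) (by linarith) (by linarith) (by linarith)
    rw [add_halves, hlt (t / 2) (by linarith) (by linarith),
      ← ENNReal.ofReal_mul (Real.exp_pos _).le, ← Real.exp_add, ← add_mul, add_halves] at h2
    exact h2

section Moments

variable {Ω : Type*} [MeasurableSpace Ω] {P : Measure Ω} [IsProbabilityMeasure P] {t₀ : ℝ}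
  {h₀ : 0 ≤ t₀} {Y : Set.Icc (0 : ℝ) t₀ → Ω → ℝ}

/-- The exponential is unbounded, so stochastic continuity does not directly give continuity of the
exponential moment. Fatou's lemma along an almost surely convergent subsequence gives the
semicontinuity that `eq_exp_of_multiplicative` asks for. -/
theorem IsLevyProcess.expMoment_levyLaw (hY : IsLevyProcess P Y) (ht₀ : 1 ≤ t₀) {u ψ : ℝ}
    (h1 : expMoment (levyLaw P h₀ Y 1) u = ENNReal.ofReal (Real.exp ψ)) {t : ℝ} (ht : 0 < t)
    (ht' : t ≤ t₀) : expMoment (levyLaw P h₀ Y t) u = ENNReal.ofReal (Real.exp (t * ψ)) := by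
  refine eq_exp_of_multiplicative ht₀ (G := fun t => expMoment (levyLaw P h₀ Y t) u) ?_ ?_ h1 ht ht'
  · intro s t hs ht hst
    have := hY.isProbabilityMeasure_levyLaw (h₀ := h₀) s
    have := hY.isProbabilityMeasure_levyLaw (h₀ := h₀) t
    rw [hY.levyLaw_add hs ht hst, expMoment_conv]
  · intro t ht r hr hrt hG
    have h2 : Tendsto (fun k => (⟨r k, hr k⟩ : Set.Icc (0 : ℝ) t₀)) atTop (𝓝 ⟨t, ht⟩) :=
      tendsto_subtype_rng.2 hrt
    obtain ⟨ns, hns, hae⟩ := ((hY.stochasticallyContinuous ⟨t, ht⟩).comp h2).exists_seq_tendsto_ae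
    have hval : ∀ s : Set.Icc (0 : ℝ) t₀, expMoment (levyLaw P h₀ Y s) u =
        ∫⁻ ω, ENNReal.ofReal (Real.exp (u * Y s ω)) ∂P := by
      intro s
      rw [levyLaw_coe, expMoment, lintegral_map (by fun_prop) (hY.measurable s)]
    have hfat : ∫⁻ ω, ENNReal.ofReal (Real.exp (u * Y ⟨t, ht⟩ ω)) ∂P ≤
        liminf (fun n => ∫⁻ ω, ENNReal.ofReal (Real.exp (u * Y ⟨r (ns n), hr _⟩ ω)) ∂P) atTop := by
      refine le_trans (le_of_eq ?_) (lintegral_liminf_le fun n => ?_)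
      · refine lintegral_congr_ae ?_
        filter_upwards [hae] with ω hω
        refine (Tendsto.liminf_eq ?_).symm
        exact (ENNReal.continuous_ofReal.tendsto _).comp
          ((Real.continuous_exp.tendsto _).comp (hω.const_mul u))
      · have := hY.measurable ⟨r (ns n), hr _⟩
        fun_prop
    have hlim : Tendsto (fun n => ∫⁻ ω, ENNReal.ofReal (Real.exp (u * Y ⟨r (ns n), hr _⟩ ω)) ∂P)
        atTop (𝓝 (ENNReal.ofReal (Real.exp (t * ψ)))) := by
      have h3 : ∀ n, ∫⁻ ω, ENNReal.ofReal (Real.exp (u * Y ⟨r (ns n), hr _⟩ ω)) ∂P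
          = ENNReal.ofReal (Real.exp (r (ns n) * ψ)) := by
        intro n
        rw [← hval]
        exact hG (ns n)
      simp_rw [h3]
      exact (ENNReal.continuous_ofReal.tendsto _).comp
          ((Real.continuous_exp.tendsto _).comp ((hrt.comp hns.tendsto_atTop).mul_const ψ))
    rw [hlim.liminf_eq, ← hval] at hfat
    exact hfat

end Moments

lemma integrable_of_expMoment_ne_top {m : Measure ℝ} {u : ℝ} (h : expMoment m u ≠ ∞) :
    Integrable (fun x => Real.exp (u * x)) m := by
  refine ⟨by fun_prop, ?_⟩
  rw [hasFiniteIntegral_iff_ofReal (Eventually.of_forall fun x => (Real.exp_pos _).le)]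
  exact h.lt_top

/-- Two probability measures on the line with the same finite exponential moments near `0` are
equal. -/
theorem ext_of_expMoment {m m' : Measure ℝ} [IsProbabilityMeasure m] [IsProbabilityMeasure m']
    {ε : ℝ} (hε : 0 < ε) (hfin : ∀ u, |u| < ε → expMoment m u ≠ ∞)
    (h : ∀ u, |u| < ε → expMoment m u = expMoment m' u) : m = m' := by
  have hfin' : ∀ u, |u| < ε → expMoment m' u ≠ ∞ := fun u hu => h u hu ▸ hfin u hu
  have hint : ∀ {n : Measure ℝ}, (∀ u, |u| < ε → expMoment n u ≠ ∞) →
      Set.Ioo (-ε) ε ⊆ interior (integrableExpSet id n) := by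
    intro n hn
    refine interior_maximal (fun u hu => ?_) isOpen_Ioo
    exact integrable_of_expMoment_ne_top (hn u (abs_lt.2 hu))
  -- Both complex moment generating functions are analytic on this vertical strip. They agree at the
  -- real points `1 / (n + 1)`, which accumulate at zero, hence on the imaginary axis, where they
  -- are the characteristic functions.
  let U : Set ℂ := Complex.re ⁻¹' Set.Ioo (-ε) ε
  have hU : IsPreconnected U :=
    ((convex_Ioo (-ε) ε).linear_preimage Complex.reLm).isPreconnected
  have hX : AnalyticOnNhd ℂ (complexMGF id m) U := fun z hz =>
    analyticAt_complexMGF (hint hfin hz)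
  have hX' : AnalyticOnNhd ℂ (complexMGF id m') U := fun z hz =>
    analyticAt_complexMGF (hint hfin' hz)
  have h0 : (0 : ℂ) ∈ U := by simp [U, hε]
  have hreal : ∀ u : ℝ, |u| < ε → complexMGF id m u = complexMGF id m' u := by
    intro u hu
    rw [complexMGF_ofReal, complexMGF_ofReal]
    congr 1
    have h1 : ∀ n : Measure ℝ, mgf id n u = (expMoment n u).toReal := by
      intro n
      rw [mgf, integral_eq_lintegral_of_nonneg_ae
        (Eventually.of_forall fun x => (Real.exp_pos _).le) (by fun_prop)]
      rfl
    rw [h1, h1, h u hu]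
  have hfreq : ∃ᶠ z in 𝓝[≠] (0 : ℂ), complexMGF id m z = complexMGF id m' z := by
    have ht : Tendsto (fun n : ℕ => ((1 / ((n : ℝ) + 1) : ℝ) : ℂ)) atTop (𝓝[≠] 0) := by
      refine tendsto_nhdsWithin_iff.2 ⟨?_, Eventually.of_forall fun n => ?_⟩
      · have := (Complex.continuous_ofReal.tendsto 0).comp
          (tendsto_one_div_add_atTop_nhds_zero_nat (𝕜 := ℝ))
        rwa [Complex.ofReal_zero] at this
      · have : (1 / ((n : ℝ) + 1) : ℝ) ≠ 0 := by positivity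
        exact Complex.ofReal_ne_zero.2 this
    refine ht.frequently (Eventually.frequently ?_)
    have h2 := (tendsto_one_div_add_atTop_nhds_zero_nat (𝕜 := ℝ)).eventually_lt_const hε
    filter_upwards [h2] with n hn
    refine hreal _ ?_
    rwa [abs_of_pos (by positivity)]
  have heq := hX.eqOn_of_preconnected_of_frequently_eq hX' hU h0 hfreq
  refine Measure.ext_of_charFun (funext fun u => ?_)
  rw [← complexMGF_id_mul_I, ← complexMGF_id_mul_I]
  exact heq (by simp [U, hε])

/-! ### The inverse Gaussian distribution -/

/-- The inversion `x ↦ c / x` serves twice: it exchanges two weights of the inverse Gaussian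
density, and it turns the integral for `K₁` into a variance mixture. -/
lemma lintegral_Ioi_comp_const_div {c : ℝ} (hc : 0 < c) (g : ℝ → ℝ≥0∞) :
    ∫⁻ x in Set.Ioi (0 : ℝ), g x
      = ∫⁻ x in Set.Ioi (0 : ℝ), ENNReal.ofReal (c / x ^ 2) * g (c / x) := by
  have himg : (fun x : ℝ => c / x) '' Set.Ioi 0 = Set.Ioi 0 := by
    ext y
    constructor
    · rintro ⟨x, hx, rfl⟩
      exact div_pos hc hx
    · intro hy
      exact ⟨c / y, div_pos hc hy, div_div_cancel₀ hc.ne'⟩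
  have hder : ∀ x ∈ Set.Ioi (0 : ℝ),
      HasDerivWithinAt (fun x : ℝ => c / x) (-(c / x ^ 2)) (Set.Ioi 0) x := by
    intro x hx
    have h := ((hasDerivAt_inv (ne_of_gt hx)).const_mul c).hasDerivWithinAt (s := Set.Ioi 0)
    simpa [div_eq_mul_inv] using h
  have hinj : Set.InjOn (fun x : ℝ => c / x) (Set.Ioi 0) := by
    intro x hx y hy hxy
    have h : c / x = c / y := hxy
    rw [← div_div_cancel₀ (b := x) hc.ne', h, div_div_cancel₀ hc.ne']
  have h := lintegral_image_eq_lintegral_abs_deriv_mul measurableSet_Ioi hder hinj g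
  rw [himg] at h
  rw [h]
  refine setLIntegral_congr_fun measurableSet_Ioi fun x hx => ?_
  have hx' : (0 : ℝ) < x := hx
  simp only [abs_neg, abs_of_pos (div_pos hc (pow_pos hx' 2))]

/-- The density of the inverse Gaussian distribution on `(0, ∞)`. -/
noncomputable def inverseGaussianPDF (μ l x : ℝ) : ℝ :=
  Real.sqrt (l / (2 * Real.pi * x ^ 3)) * Real.exp (-l * (x - μ) ^ 2 / (2 * μ ^ 2 * x))

@[fun_prop]
lemma measurable_inverseGaussianPDF (μ l : ℝ) : Measurable (inverseGaussianPDF μ l) := by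
  unfold inverseGaussianPDF
  fun_prop

lemma inverseGaussianPDF_nonneg (μ l x : ℝ) : 0 ≤ inverseGaussianPDF μ l x := by
  unfold inverseGaussianPDF
  positivity

lemma lintegral_inverseGaussian (μ l : ℝ) {f : ℝ → ℝ≥0∞} (hf : Measurable f) :
    ∫⁻ x, f x ∂(inverseGaussian μ l)
      = ∫⁻ x in Set.Ioi 0, ENNReal.ofReal (inverseGaussianPDF μ l x) * f x := by
  have : inverseGaussian μ l = (volume.restrict (Set.Ioi 0)).withDensity fun x =>
    ENNReal.ofReal (inverseGaussianPDF μ l x) := rfl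
  rw [this, lintegral_withDensity_eq_lintegral_mul _ (by fun_prop) hf]
  rfl

lemma inverseGaussianPDF_inversion {μ l x : ℝ} (hμ : 0 < μ) (hx : 0 < x) :
    μ ^ 2 / x ^ 2 * inverseGaussianPDF μ l (μ ^ 2 / x) = x / μ * inverseGaussianPDF μ l x := by
  unfold inverseGaussianPDF
  have h1 : -l * (μ ^ 2 / x - μ) ^ 2 / (2 * μ ^ 2 * (μ ^ 2 / x))
      = -l * (x - μ) ^ 2 / (2 * μ ^ 2 * x) := by
    field_simp
    ring
  have h2 : l / (2 * Real.pi * (μ ^ 2 / x) ^ 3)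
      = (x ^ 3 / μ ^ 3) ^ 2 * (l / (2 * Real.pi * x ^ 3)) := by
    field_simp
  rw [h1, h2, Real.sqrt_mul (by positivity), Real.sqrt_sq (by positivity)]
  field_simp

/-- Pulling the standard Gaussian back along the bijection `φ` produces the density with weight `(1
+ x / μ) / 2`. By inversion the weights `1` and `x / μ` have the same integral `J`, so `1 = (J + J)
/ 2`. -/
lemma lintegral_inverseGaussianPDF {μ l : ℝ} (hμ : 0 < μ) (hl : 0 < l) :
    ∫⁻ x in Set.Ioi 0, ENNReal.ofReal (inverseGaussianPDF μ l x) = 1 := by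
  set J := ∫⁻ x in Set.Ioi 0, ENNReal.ofReal (inverseGaussianPDF μ l x) with hJ
  have hA : J = ∫⁻ x in Set.Ioi 0, ENNReal.ofReal (x / μ * inverseGaussianPDF μ l x) := by
    rw [hJ, lintegral_Ioi_comp_const_div (pow_pos hμ 2)]
    refine setLIntegral_congr_fun measurableSet_Ioi fun x hx => ?_
    have hx' : (0 : ℝ) < x := hx
    rw [← ENNReal.ofReal_mul (by positivity), inverseGaussianPDF_inversion hμ hx']
  let φ : ℝ → ℝ := fun x => Real.sqrt l * (Real.sqrt x / μ - (Real.sqrt x)⁻¹)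
  have hder : ∀ x ∈ Set.Ioi (0 : ℝ), HasDerivWithinAt φ
      (Real.sqrt (l / x ^ 3) * (1 + x / μ) / 2) (Set.Ioi 0) x := by
    intro x hx
    have hx' : (0 : ℝ) < x := hx
    have hs : 0 < Real.sqrt x := Real.sqrt_pos.2 hx'
    have h1 := Real.hasDerivAt_sqrt hx'.ne'
    have h2 := ((h1.div_const μ).sub (h1.inv hs.ne')).const_mul (Real.sqrt l)
    refine (h2.congr_deriv ?_).hasDerivWithinAt
    have h3 : Real.sqrt (x ^ 3) = x * Real.sqrt x := by
      rw [pow_succ, Real.sqrt_mul (by positivity), Real.sqrt_sq hx'.le]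
    rw [Real.sqrt_div hl.le, h3]
    have h4 := Real.sq_sqrt hx'.le
    rw [h4]
    field_simp
    ring
  have hmono : StrictMonoOn φ (Set.Ioi 0) := by
    intro x hx y hy hxy
    have hs : 0 < Real.sqrt x := Real.sqrt_pos.2 hx
    have hst : Real.sqrt x < Real.sqrt y := Real.sqrt_lt_sqrt (le_of_lt hx) hxy
    refine mul_lt_mul_of_pos_left ?_ (Real.sqrt_pos.2 hl)
    have h1 : (Real.sqrt y)⁻¹ < (Real.sqrt x)⁻¹ := inv_strictAnti₀ hs hst
    have h2 : Real.sqrt x / μ < Real.sqrt y / μ := by gcongr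
    linarith
  have himg : φ '' Set.Ioi 0 = Set.univ := by
    refine Set.eq_univ_of_forall fun z => ?_
    have hl' := Real.sqrt_pos.2 hl
    set c := μ * z / Real.sqrt l with hc
    -- With `w = √x`, solving `φ x = z` means `w² = c w + μ`; this is its positive root.
    set w := (c + Real.sqrt (c ^ 2 + 4 * μ)) / 2 with hw
    have hD : 0 ≤ c ^ 2 + 4 * μ := by positivity
    have hw0 : 0 < w := by
      have : |c| < Real.sqrt (c ^ 2 + 4 * μ) := by
        rw [← Real.sqrt_sq_eq_abs]
        exact Real.sqrt_lt_sqrt (sq_nonneg c) (by linarith)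
      have := neg_abs_le c
      rw [hw]
      linarith
    have hww : w ^ 2 = c * w + μ := by
      have := Real.sq_sqrt hD
      rw [hw]
      nlinarith
    refine ⟨w ^ 2, pow_pos hw0 2, ?_⟩
    simp only [φ]
    rw [Real.sqrt_sq hw0.le]
    have h1 : w / μ - w⁻¹ = c / μ := by
      field_simp
      linarith
    rw [h1, hc]
    field_simp
  have hB := lintegral_image_eq_lintegral_abs_deriv_mul measurableSet_Ioi hder hmono.injOn
    (gaussianPDF 0 1)
  rw [himg, Measure.restrict_univ, lintegral_gaussianPDF_eq_one 0 one_ne_zero] at hB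
  have hC : (2 : ℝ≥0∞) * 1 = 2 * J := by
    calc (2 : ℝ≥0∞) * 1 = ∫⁻ x in Set.Ioi 0, (ENNReal.ofReal (inverseGaussianPDF μ l x)
            + ENNReal.ofReal (x / μ * inverseGaussianPDF μ l x)) := by
          rw [hB, ← lintegral_const_mul' _ _ (by simp)]
          refine setLIntegral_congr_fun measurableSet_Ioi fun x hx => ?_
          have hx' : (0 : ℝ) < x := hx
          have hp := inverseGaussianPDF_nonneg μ l x
          have h2 : (2 : ℝ≥0∞) = ENNReal.ofReal 2 := by simp
          rw [← ENNReal.ofReal_add hp (by positivity), abs_of_nonneg (by positivity), gaussianPDF,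
            h2, ← ENNReal.ofReal_mul (by positivity), ← ENNReal.ofReal_mul (by positivity)]
          congr 1
          have hs : 0 < Real.sqrt x := Real.sqrt_pos.2 hx'
          have h5 : φ x ^ 2 = l * (x - μ) ^ 2 / (μ ^ 2 * x) := by
            have h4 := Real.sq_sqrt hx'.le
            have h6 := Real.sq_sqrt hl.le
            have h7 : Real.sqrt x / μ - (Real.sqrt x)⁻¹ = (x - μ) / (μ * Real.sqrt x) := by
              field_simp
              rw [h4]
            simp only [φ]
            rw [h7, mul_pow, div_pow, mul_pow, h4, h6]
            ring
          have h8 : l / (2 * Real.pi * x ^ 3) = (l / x ^ 3) * (2 * Real.pi)⁻¹ := by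
            field_simp
          have h9 : -(φ x) ^ 2 / 2 = -l * (x - μ) ^ 2 / (2 * μ ^ 2 * x) := by
            rw [h5]
            field_simp
          rw [inverseGaussianPDF, h8, Real.sqrt_mul (by positivity), Real.sqrt_inv, gaussianPDFReal]
          simp only [sub_zero, NNReal.coe_one, mul_one, h9]
          ring
      _ = J + J := by
          rw [lintegral_add_left (by fun_prop), ← hA]
      _ = 2 * J := (two_mul J).symm
  have := (ENNReal.mul_right_inj (by simp) (by simp)).1 hC
  exact this.symm

/-- Exponential tilting stays in the family: the tilted density is a constant times the density of
`IG(μ / c, l)`, whose total mass is one, and that constant is the moment. -/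
lemma expMoment_inverseGaussian {μ l θ : ℝ} (hμ : 0 < μ) (hl : 0 < l)
    (hθ : 2 * μ ^ 2 * θ / l < 1) :
    expMoment (inverseGaussian μ l) θ
      = ENNReal.ofReal (Real.exp (l / μ * (1 - Real.sqrt (1 - 2 * μ ^ 2 * θ / l)))) := by
  set c := Real.sqrt (1 - 2 * μ ^ 2 * θ / l) with hc
  have hc0 : 0 < c := Real.sqrt_pos.2 (by linarith)
  have hcc : c ^ 2 = 1 - 2 * μ ^ 2 * θ / l := Real.sq_sqrt (by linarith)
  rw [expMoment, lintegral_inverseGaussian _ _ (by fun_prop)]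
  have h1 : ∀ x ∈ Set.Ioi (0 : ℝ), ENNReal.ofReal (inverseGaussianPDF μ l x) *
      ENNReal.ofReal (Real.exp (θ * x)) = ENNReal.ofReal (Real.exp (l / μ * (1 - c))) *
        ENNReal.ofReal (inverseGaussianPDF (μ / c) l x) := by
    intro x hx
    have hx' : (0 : ℝ) < x := hx
    rw [← ENNReal.ofReal_mul (inverseGaussianPDF_nonneg _ _ _),
      ← ENNReal.ofReal_mul (Real.exp_pos _).le]
    congr 1
    rw [inverseGaussianPDF, inverseGaussianPDF, mul_assoc, ← Real.exp_add,
      mul_left_comm (Real.exp (l / μ * (1 - c))), ← Real.exp_add]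
    congr 2
    have hθ' : θ = (1 - c ^ 2) * l / (2 * μ ^ 2) := by
      rw [hcc]
      field_simp
      ring
    rw [hθ']
    field_simp
    ring
  rw [setLIntegral_congr_fun measurableSet_Ioi h1, lintegral_const_mul' _ _ (by simp),
    lintegral_inverseGaussianPDF (by positivity) hl, mul_one]

lemma isProbabilityMeasure_inverseGaussian {μ l : ℝ} (hμ : 0 < μ) (hl : 0 < l) :
    IsProbabilityMeasure (inverseGaussian μ l) := by
  constructor
  rw [← lintegral_one, lintegral_inverseGaussian _ _ measurable_const]
  simp only [mul_one]
  exact lintegral_inverseGaussianPDF hμ hl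

/-! ### The normal inverse Gaussian distribution -/

/-- The function `z ↦ z K₁(z)`, given by `½ ∫₀^∞ exp(-(w + z² / w) / 2) dw`. -/
noncomputable def besselTail (z : ℝ) : ℝ :=
  (1 / 2) * ∫ w in Set.Ioi (0 : ℝ), Real.exp (-(w + z ^ 2 / w) / 2)

lemma integrableOn_exp_neg_half : IntegrableOn (fun w : ℝ => Real.exp (-w / 2)) (Set.Ioi 0) := by
  have := exp_neg_integrableOn_Ioi 0 (b := 1 / 2) (by norm_num)
  refine this.congr_fun (fun w _ => ?_) measurableSet_Ioi
  simp only
  congr 1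
  ring

lemma integrableOn_besselTail (z : ℝ) :
    IntegrableOn (fun w : ℝ => Real.exp (-(w + z ^ 2 / w) / 2)) (Set.Ioi 0) := by
  refine integrableOn_exp_neg_half.mono' (Measurable.aestronglyMeasurable (by fun_prop)) ?_
  filter_upwards [ae_restrict_mem measurableSet_Ioi] with w hw
  have hw' : (0 : ℝ) < w := hw
  rw [Real.norm_of_nonneg (Real.exp_pos _).le]
  refine Real.exp_le_exp.2 ?_
  have : 0 ≤ z ^ 2 / w := by positivity
  linarith

lemma antitoneOn_besselTail : AntitoneOn besselTail (Set.Ici 0) := by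
  intro x hx y _ hxy
  have hx' : (0 : ℝ) ≤ x := hx
  unfold besselTail
  gcongr ?_ * ?_
  refine setIntegral_mono_on (integrableOn_besselTail y) (integrableOn_besselTail x)
    measurableSet_Ioi fun w hw => ?_
  have hw' : (0 : ℝ) < w := hw
  gcongr

lemma besselTail_pos (z : ℝ) : 0 < besselTail z := by
  unfold besselTail
  refine mul_pos (by norm_num) ?_
  rw [setIntegral_pos_iff_support_of_nonneg_ae
    (Eventually.of_forall fun w => (Real.exp_pos _).le) (integrableOn_besselTail z)]
  have : (Function.support fun w : ℝ => Real.exp (-(w + z ^ 2 / w) / 2)) = Set.univ :=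
    Set.eq_univ_of_forall fun w => (Real.exp_pos _).ne'
  rw [this, Set.univ_inter]
  simp

lemma besselTail_le_one {z : ℝ} (hz : 0 ≤ z) : besselTail z ≤ 1 := by
  refine (antitoneOn_besselTail Set.self_mem_Ici hz hz).trans ?_
  unfold besselTail
  have h := integral_exp_mul_Ioi (a := -1 / 2) (by norm_num) 0
  have h1 : ∀ w : ℝ, Real.exp (-(w + 0 ^ 2 / w) / 2) = Real.exp (-1 / 2 * w) := by
    intro w
    congr 1
    ring
  simp_rw [h1, h]
  norm_num

/-- Substitute `w = z y` in the integral for `K₁`. The product extends continuously to `z = 0`,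
which isolates the singularity `1 / z`. -/
lemma mul_besselK1 {z : ℝ} (hz : 0 < z) : z * besselK1 z = besselTail z := by
  unfold besselK1 besselTail
  have h := integral_comp_mul_left_Ioi (fun w : ℝ => Real.exp (-(w + z ^ 2 / w) / 2)) 0 hz
  rw [mul_zero, smul_eq_mul, eq_inv_mul_iff_mul_eq₀ hz.ne'] at h
  rw [← h]
  have h1 : ∀ y : ℝ, -z * (y + y⁻¹) / 2 = -(z * y + z ^ 2 / (z * y)) / 2 := by
    intro y
    have : z ^ 2 / (z * y) = z * y⁻¹ := by
      rw [sq, mul_div_mul_left _ _ hz.ne', div_eq_mul_inv]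
    rw [this]
    ring
  simp_rw [h1]
  ring

lemma integrableOn_besselK1 {z : ℝ} (hz : 0 < z) :
    IntegrableOn (fun y : ℝ => Real.exp (-z * (y + y⁻¹) / 2)) (Set.Ioi 0) := by
  refine (exp_neg_integrableOn_Ioi 0 (b := z / 2) (by positivity)).mono'
    (Measurable.aestronglyMeasurable (by fun_prop)) ?_
  filter_upwards [ae_restrict_mem measurableSet_Ioi] with w hw
  have hw' : (0 : ℝ) < w := hw
  rw [Real.norm_of_nonneg (Real.exp_pos _).le]
  refine Real.exp_le_exp.2 ?_
  have : 0 ≤ z * w⁻¹ := by positivity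
  linarith

/-- The density of the symmetric normal inverse Gaussian distribution. -/
noncomputable def symmetricNIGPDF (α δ x : ℝ) : ℝ :=
  α * Real.exp (δ * α) / (Real.pi * Real.sqrt (1 + x ^ 2 / δ ^ 2)) *
      besselK1 (δ * α * Real.sqrt (1 + x ^ 2 / δ ^ 2))

/-- The density of the centered normal distribution with variance `w`. -/
noncomputable def normalKernel (w x : ℝ) : ℝ :=
  Real.sqrt ((2 * Real.pi * w)⁻¹) * Real.exp (-x ^ 2 / (2 * w))

/-- The symmetric normal inverse Gaussian distribution is a normal mixture, the variance having an
inverse Gaussian distribution. -/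
lemma ofReal_symmetricNIGPDF {α δ : ℝ} (hα : 0 < α) (hδ : 0 < δ) (x : ℝ) :
    ENNReal.ofReal (symmetricNIGPDF α δ x) = ∫⁻ w in Set.Ioi 0,
      ENNReal.ofReal (inverseGaussianPDF (δ / α) (δ ^ 2) w) * ENNReal.ofReal (normalKernel w x) := by
  set S := Real.sqrt (1 + x ^ 2 / δ ^ 2) with hS
  have hS0 : 0 < S := Real.sqrt_pos.2 (by positivity)
  have hSS : S ^ 2 = 1 + x ^ 2 / δ ^ 2 := Real.sq_sqrt (by positivity)
  have hz : 0 < δ * α * S := by positivity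
  have h1 : ENNReal.ofReal (symmetricNIGPDF α δ x) = ∫⁻ y in Set.Ioi 0,
      ENNReal.ofReal (α * Real.exp (δ * α) / (Real.pi * S) * (1 / 2)) *
        ENNReal.ofReal (Real.exp (-(δ * α * S) * (y + y⁻¹) / 2)) := by
    rw [lintegral_const_mul' _ _ (by simp), ← ofReal_integral_eq_lintegral_ofReal
      (integrableOn_besselK1 hz) (Eventually.of_forall fun y => (Real.exp_pos _).le),
      ← ENNReal.ofReal_mul (by positivity)]
    congr 1
    rw [symmetricNIGPDF, ← hS, besselK1]
    ring
  -- The inversion `y = δ S / (α w)` matches the exponents: `w` becomes the variance, since `x² = δ²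
  -- (S² - 1)`.
  rw [h1, lintegral_Ioi_comp_const_div (c := δ * S / α) (by positivity)]
  refine setLIntegral_congr_fun measurableSet_Ioi fun w hw => ?_
  have hw' : (0 : ℝ) < w := hw
  rw [← ENNReal.ofReal_mul (by positivity), ← ENNReal.ofReal_mul (by positivity),
    ← ENNReal.ofReal_mul (inverseGaussianPDF_nonneg _ _ _)]
  congr 1
  rw [inverseGaussianPDF, normalKernel]
  have h2 : Real.sqrt (δ ^ 2 / (2 * Real.pi * w ^ 3)) * Real.sqrt ((2 * Real.pi * w)⁻¹)
      = δ / (2 * Real.pi * w ^ 2) := by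
    rw [← Real.sqrt_mul (by positivity)]
    have : δ ^ 2 / (2 * Real.pi * w ^ 3) * (2 * Real.pi * w)⁻¹
        = (δ / (2 * Real.pi * w ^ 2)) ^ 2 := by
      field_simp
    rw [this, Real.sqrt_sq (by positivity)]
  have h3 : -(δ ^ 2) * (w - δ / α) ^ 2 / (2 * (δ / α) ^ 2 * w) + -x ^ 2 / (2 * w)
      = δ * α + -(δ * α * S) * (δ * S / α / w + (δ * S / α / w)⁻¹) / 2 := by
    have h4 : x ^ 2 = δ ^ 2 * (S ^ 2 - 1) := by
      rw [hSS]
      field_simp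
      ring
    rw [h4]
    field_simp
    ring
  rw [mul_mul_mul_comm (Real.sqrt _), h2, ← Real.exp_add, h3, Real.exp_add]
  field_simp

/-- Completing the square turns the integrand into the Gaussian density with mean `u w` and variance
`w`. -/
lemma lintegral_normalKernel {w : ℝ} (hw : 0 < w) (u : ℝ) :
    ∫⁻ x, ENNReal.ofReal (normalKernel w x) * ENNReal.ofReal (Real.exp (u * x))
      = ENNReal.ofReal (Real.exp (u ^ 2 / 2 * w)) := by
  have h := lintegral_gaussianPDF_eq_one (u * w) (v := w.toNNReal)
    (Real.toNNReal_pos.2 hw).ne'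
  rw [← mul_one (ENNReal.ofReal (Real.exp (u ^ 2 / 2 * w))), ← h,
    ← lintegral_const_mul' _ _ (by simp)]
  refine lintegral_congr fun x => ?_
  simp only [gaussianPDF, gaussianPDFReal, normalKernel]
  rw [← ENNReal.ofReal_mul (by positivity),
    ← ENNReal.ofReal_mul (by positivity)]
  congr 1
  rw [Real.coe_toNNReal _ hw.le, Real.sqrt_inv, mul_assoc, ← Real.exp_add,
    mul_left_comm (Real.exp (u ^ 2 / 2 * w)), ← Real.exp_add]
  congr 2
  field_simp
  ring

/-- By Tonelli, integrate over `x` first. Given the variance `w` the moment is `exp (u² w / 2)`, so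
the result is the inverse Gaussian moment at `θ = u² / 2`. -/
lemma expMoment_symmetricNIG {α δ u : ℝ} (hα : 0 < α) (hδ : 0 < δ) (hu : |u| < α) :
    expMoment (symmetricNIG α δ) u
      = ENNReal.ofReal (Real.exp (δ * α * (1 - Real.sqrt (1 - u ^ 2 / α ^ 2)))) := by
  have hmeas : Measurable (Function.uncurry fun x w : ℝ =>
      ENNReal.ofReal (inverseGaussianPDF (δ / α) (δ ^ 2) w) *
        ENNReal.ofReal (normalKernel w x)) := by
    unfold inverseGaussianPDF normalKernel Function.uncurry
    fun_prop
  have h0 : symmetricNIG α δ = volume.withDensity fun x => ∫⁻ w in Set.Ioi 0,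
      ENNReal.ofReal (inverseGaussianPDF (δ / α) (δ ^ 2) w) *
        ENNReal.ofReal (normalKernel w x) := by
    simp_rw [← ofReal_symmetricNIGPDF hα hδ]
    rfl
  rw [expMoment, h0, lintegral_withDensity_eq_lintegral_mul _
    (Measurable.lintegral_prod_right hmeas) (by fun_prop)]
  simp only [Pi.mul_apply]
  have h1 : ∀ x : ℝ, (∫⁻ w in Set.Ioi 0,
      ENNReal.ofReal (inverseGaussianPDF (δ / α) (δ ^ 2) w) * ENNReal.ofReal (normalKernel w x)) *
        ENNReal.ofReal (Real.exp (u * x)) = ∫⁻ w in Set.Ioi 0,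
      ENNReal.ofReal (inverseGaussianPDF (δ / α) (δ ^ 2) w) * (ENNReal.ofReal (normalKernel w x) *
        ENNReal.ofReal (Real.exp (u * x))) := by
    intro x
    rw [← lintegral_mul_const' _ _ (by simp)]
    simp_rw [mul_assoc]
  simp_rw [h1]
  rw [lintegral_lintegral_swap]
  · have h2 : ∀ w ∈ Set.Ioi (0 : ℝ), (∫⁻ x, ENNReal.ofReal (inverseGaussianPDF (δ / α) (δ ^ 2) w) *
        (ENNReal.ofReal (normalKernel w x) * ENNReal.ofReal (Real.exp (u * x))))
        = ENNReal.ofReal (inverseGaussianPDF (δ / α) (δ ^ 2) w) *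
          ENNReal.ofReal (Real.exp (u ^ 2 / 2 * w)) := by
      intro w hw
      rw [lintegral_const_mul' _ _ (by simp), lintegral_normalKernel hw]
    rw [setLIntegral_congr_fun measurableSet_Ioi h2]
    have hua : u ^ 2 / α ^ 2 < 1 := by
      rw [div_lt_one (by positivity)]
      exact sq_lt_sq.2 (by rwa [abs_of_pos hα])
    have h4 : 2 * (δ / α) ^ 2 * (u ^ 2 / 2) / δ ^ 2 = u ^ 2 / α ^ 2 := by
      field_simp
    have h3 := expMoment_inverseGaussian (μ := δ / α) (l := δ ^ 2) (θ := u ^ 2 / 2)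
      (by positivity) (by positivity) (by rwa [h4])
    have h5 : δ ^ 2 / (δ / α) = δ * α := by
      field_simp
    rw [expMoment, lintegral_inverseGaussian _ _ (by fun_prop), h4, h5] at h3
    exact h3
  · unfold inverseGaussianPDF normalKernel Function.uncurry
    fun_prop

lemma isProbabilityMeasure_symmetricNIG {α δ : ℝ} (hα : 0 < α) (hδ : 0 < δ) :
    IsProbabilityMeasure (symmetricNIG α δ) := by
  constructor
  have h := expMoment_symmetricNIG hα hδ (u := 0) (by simpa using hα)
  simpa [expMoment] using h

/-! ### Lévy processes with inverse Gaussian and normal inverse Gaussian marginals -/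

section Marginals

variable {Ω : Type*} [MeasurableSpace Ω] {P : Measure Ω} [IsProbabilityMeasure P] {t₀ : ℝ}
  {h₀ : 0 ≤ t₀} {Y : Set.Icc (0 : ℝ) t₀ → Ω → ℝ}

/-- The exponent involves the parameters only through `l / μ` and `μ² / l`. Passing to `(tμ, t² l)`
multiplies the first by `t` and fixes the second. -/
theorem IsLevyProcess.levyLaw_eq_inverseGaussian (hY : IsLevyProcess P Y) (ht₀ : 1 ≤ t₀) {μ l : ℝ}
    (hμ : 0 < μ) (hl : 0 < l) (h1 : levyLaw P h₀ Y 1 = inverseGaussian μ l) {t : ℝ} (ht : 0 < t)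
    (ht' : t ≤ t₀) : levyLaw P h₀ Y t = inverseGaussian (t * μ) (t ^ 2 * l) := by
  have := hY.isProbabilityMeasure_levyLaw (h₀ := h₀) t
  have := isProbabilityMeasure_inverseGaussian (μ := t * μ) (l := t ^ 2 * l) (by positivity)
    (by positivity)
  have hε : 0 < l / (2 * μ ^ 2) := by positivity
  have hval : ∀ u, |u| < l / (2 * μ ^ 2) → expMoment (levyLaw P h₀ Y t) u = ENNReal.ofReal
      (Real.exp (t * (l / μ * (1 - Real.sqrt (1 - 2 * μ ^ 2 * u / l))))) := by
    intro u hu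
    refine hY.expMoment_levyLaw ht₀ ?_ ht ht'
    rw [h1, expMoment_inverseGaussian hμ hl]
    rw [div_lt_one hl, mul_comm, ← lt_div_iff₀ (by positivity)]
    exact (le_abs_self u).trans_lt hu
  refine ext_of_expMoment hε (fun u hu => ?_) (fun u hu => ?_)
  · rw [hval u hu]
    exact ENNReal.ofReal_ne_top
  · rw [hval u hu, expMoment_inverseGaussian (by positivity) (by positivity)]
    · have h2 : 2 * (t * μ) ^ 2 * u / (t ^ 2 * l) = 2 * μ ^ 2 * u / l := by
        field_simp
      have h3 : t ^ 2 * l / (t * μ) = t * (l / μ) := by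
        field_simp
      rw [h2, h3, mul_assoc t]
    · have h2 : 2 * (t * μ) ^ 2 * u / (t ^ 2 * l) = 2 * μ ^ 2 * u / l := by
        field_simp
      rw [h2, div_lt_one hl, mul_comm, ← lt_div_iff₀ (by positivity)]
      exact (le_abs_self u).trans_lt hu

theorem IsLevyProcess.levyLaw_eq_symmetricNIG (hY : IsLevyProcess P Y) (ht₀ : 1 ≤ t₀) {α δ : ℝ}
    (hα : 0 < α) (hδ : 0 < δ) (h1 : levyLaw P h₀ Y 1 = symmetricNIG α δ) {t : ℝ} (ht : 0 < t)
    (ht' : t ≤ t₀) : levyLaw P h₀ Y t = symmetricNIG α (t * δ) := by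
  have := hY.isProbabilityMeasure_levyLaw (h₀ := h₀) t
  have := isProbabilityMeasure_symmetricNIG (α := α) (δ := t * δ) hα (by positivity)
  have hval : ∀ u, |u| < α → expMoment (levyLaw P h₀ Y t) u = ENNReal.ofReal
      (Real.exp (t * (δ * α * (1 - Real.sqrt (1 - u ^ 2 / α ^ 2))))) := by
    intro u hu
    refine hY.expMoment_levyLaw ht₀ ?_ ht ht'
    rw [h1, expMoment_symmetricNIG hα hδ hu]
  refine ext_of_expMoment hα (fun u hu => ?_) (fun u hu => ?_)
  · rw [hval u hu]
    exact ENNReal.ofReal_ne_top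
  · rw [hval u hu, expMoment_symmetricNIG hα (by positivity) hu]
    congr 2
    ring

end Marginals

/-! ### Condition `C_q` for families of laws with power tails -/

/-- On `|Z| > s` one has `|Z| ^ p ≤ s ^ (p - q) * |Z| ^ q`, so all constants carry over. -/
lemma SatisfiesCFinite.mono {Ω I : Type*} [MeasurableSpace Ω] {P : Measure Ω}
    {𝓗 : I → Set (Ω → ℝ)} {p q : ℝ} (hpq : p ≤ q) (h : SatisfiesCFinite P 𝓗 q)
    (hm : ∀ ξ, ∀ Z ∈ 𝓗 ξ, Measurable Z) : SatisfiesCFinite P 𝓗 p := by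
  obtain ⟨β₁, β₂, h1, h2, h3⟩ := h
  refine ⟨β₁, β₂, h1, h2, fun ξ Z hZ => ?_⟩
  obtain ⟨c, hc, hcP, hs⟩ := h3 ξ Z hZ
  refine ⟨c, hc, hcP, fun s hcs => ?_⟩
  have hs0 : 0 < s := hc.trans_le hcs
  have hmeas : MeasurableSet {ω | s < |Z ω|} := by
    have := hm ξ Z hZ
    measurability
  calc ∫⁻ ω in {ω | s < |Z ω|}, ENNReal.ofReal (|Z ω| ^ p) ∂P
      ≤ ∫⁻ ω in {ω | s < |Z ω|}, ENNReal.ofReal (s ^ (p - q)) * ENNReal.ofReal (|Z ω| ^ q) ∂P := by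
        refine setLIntegral_mono' hmeas fun ω hω => ?_
        have hω' : s < |Z ω| := hω
        rw [← ENNReal.ofReal_mul (by positivity)]
        refine ENNReal.ofReal_le_ofReal ?_
        have h4 : |Z ω| ^ p = |Z ω| ^ (p - q) * |Z ω| ^ q := by
          rw [← Real.rpow_add (hs0.trans hω'), sub_add_cancel]
        rw [h4]
        gcongr ?_ * _
        exact Real.rpow_le_rpow_of_nonpos hs0 hω'.le (by linarith)
    _ = ENNReal.ofReal (s ^ (p - q)) * ∫⁻ ω in {ω | s < |Z ω|}, ENNReal.ofReal (|Z ω| ^ q) ∂P :=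
        lintegral_const_mul' _ _ (by simp)
    _ ≤ ENNReal.ofReal (s ^ (p - q)) * (ENNReal.ofReal (β₂ * s ^ q) * P {ω | s < |Z ω|}) := by
        gcongr
        exact hs s hcs
    _ = ENNReal.ofReal (β₂ * s ^ p) * P {ω | s < |Z ω|} := by
        rw [← mul_assoc, ← ENNReal.ofReal_mul (by positivity)]
        congr 2
        rw [mul_left_comm, ← Real.rpow_add hs0, sub_add_cancel]

lemma lintegral_Ioi_rpow {p a : ℝ} (hp : p < -1) (ha : 0 < a) :
    ∫⁻ x in Set.Ioi a, ENNReal.ofReal (x ^ p) = ENNReal.ofReal (a ^ (p + 1) / (-(p + 1))) := by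
  rw [← ofReal_integral_eq_lintegral_ofReal (integrableOn_Ioi_rpow_of_lt hp ha),
    integral_Ioi_rpow_of_lt hp ha, div_neg, neg_div]
  filter_upwards [ae_restrict_mem measurableSet_Ioi] with x hx
  exact Real.rpow_nonneg (ha.trans hx).le _

/-- On `|x| > r`, the image of `m` under the absolute value has a density
`r ^ κ * x ^ (-κ - 1) * k x`, where `k` is bounded by `C`, almost decreasing with constant `K`,
and at least `c` on `[r, N r]`. -/
def HasPowerTail (m : Measure ℝ) (κ r N C c K : ℝ) : Prop :=
  ∃ k : ℝ → ℝ,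
    (∀ F : ℝ → ℝ≥0∞, Measurable F → ∀ s, r ≤ s → ∫⁻ x in {x | s < |x|}, F |x| ∂m
      = ∫⁻ x in Set.Ioi s, ENNReal.ofReal (r ^ κ * x ^ (-κ - 1) * k x) * F x) ∧
    (∀ x, r ≤ x → 0 < k x) ∧ (∀ x, r ≤ x → k x ≤ C) ∧ (∀ x, r ≤ x → x ≤ N * r → c ≤ k x) ∧
    ∀ x y, r ≤ y → y ≤ x → k x ≤ K * k y

section PowerTail

variable {m : Measure ℝ} {κ r N C c K : ℝ}

/-- The interval `(s, 2s]` alone suffices: there the power is at least its value at `2s`, and `k` is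
at least `k (2s) / K`. -/
lemma ofReal_le_setLIntegral_Ioi {k : ℝ → ℝ} (hκ : 0 < κ) (hr : 0 < r) (hK : 0 < K) {s : ℝ}
    (hs : r ≤ s) (hk2 : 0 < k (2 * s)) (hkK : ∀ x y, r ≤ y → y ≤ x → k x ≤ K * k y) :
    ENNReal.ofReal (r ^ κ * ((2 * s) ^ (-κ - 1) * (k (2 * s) / K)) * s)
      ≤ ∫⁻ x in Set.Ioi s, ENNReal.ofReal (r ^ κ * x ^ (-κ - 1) * k x) := by
  have hs0 : 0 < s := hr.trans_le hs
  calc ENNReal.ofReal (r ^ κ * ((2 * s) ^ (-κ - 1) * (k (2 * s) / K)) * s)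
      = ∫⁻ x in Set.Ioc s (2 * s),
          ENNReal.ofReal (r ^ κ * ((2 * s) ^ (-κ - 1) * (k (2 * s) / K))) := by
        rw [setLIntegral_const, Real.volume_Ioc, ← ENNReal.ofReal_mul (by positivity)]
        congr 1
        ring
    _ ≤ ∫⁻ x in Set.Ioc s (2 * s), ENNReal.ofReal (r ^ κ * x ^ (-κ - 1) * k x) := by
        refine setLIntegral_mono' measurableSet_Ioc fun x hx => ENNReal.ofReal_le_ofReal ?_
        have hx0 : 0 < x := hs0.trans hx.1
        have h4 : k (2 * s) / K ≤ k x := by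
          rw [div_le_iff₀' hK]
          exact hkK _ _ (hs.trans hx.1.le) hx.2
        have h5 : (2 * s) ^ (-κ - 1) ≤ x ^ (-κ - 1) :=
          Real.rpow_le_rpow_of_nonpos hx0 hx.2 (by linarith)
        rw [mul_assoc (r ^ κ)]
        gcongr
    _ ≤ _ := lintegral_mono_set Set.Ioc_subset_Ioi_self

/-- Split at `2s`. Below, `x ^ q ≤ (2s) ^ q`. Above, `k ≤ K * k (2s)` and `x ^ (q - κ - 1)` is
integrable. The factor `k (2s)` is absorbed by the lower bound for the tail mass at a further cost
of `K`, hence `K ^ 2`. The constant does not depend on `r`. -/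
lemma HasPowerTail.lintegral_rpow_le (h : HasPowerTail m κ r N C c K) (hr : 0 < r) (hK : 0 < K)
    {q : ℝ} (hq : 0 < q) (hqκ : q < κ) {s : ℝ} (hs : r ≤ s) :
    ∫⁻ x in {x | s < |x|}, ENNReal.ofReal (|x| ^ q) ∂m
      ≤ ENNReal.ofReal (2 ^ q * (1 + 2 * K ^ 2 / (κ - q)) * s ^ q) * m {x | s < |x|} := by
  obtain ⟨k, hden, hk0, -, -, hkK⟩ := h
  have hs0 : 0 < s := hr.trans_le hs
  have hκq : 0 < κ - q := sub_pos.2 hqκ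
  have hm : m {x | s < |x|} = ∫⁻ x in Set.Ioi s, ENNReal.ofReal (r ^ κ * x ^ (-κ - 1) * k x) := by
    have := hden (fun _ => 1) measurable_const s hs
    simpa using this
  rw [hden (fun x => ENNReal.ofReal (x ^ q)) (by fun_prop) s hs]
  set D : ℝ → ℝ≥0∞ := fun x => ENNReal.ofReal (r ^ κ * x ^ (-κ - 1) * k x) with hD
  have hunion : Set.Ioi s = Set.Ioc s (2 * s) ∪ Set.Ioi (2 * s) :=
    (Set.Ioc_union_Ioi_eq_Ioi (by linarith)).symm
  have hdisj : Disjoint (Set.Ioc s (2 * s)) (Set.Ioi (2 * s)) := by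
    rw [Set.disjoint_left]
    intro x hx hx'
    exact absurd hx.2 (not_le.2 hx')
  have h1 : ∫⁻ x in Set.Ioc s (2 * s), D x * ENNReal.ofReal (x ^ q)
      ≤ ENNReal.ofReal ((2 * s) ^ q) * m {x | s < |x|} := by
    rw [hm, ← lintegral_const_mul' _ _ (by simp)]
    refine (setLIntegral_mono' measurableSet_Ioc fun x hx => ?_).trans
      (lintegral_mono_set Set.Ioc_subset_Ioi_self)
    rw [mul_comm]
    gcongr
    · exact hs0.le.trans hx.1.le
    · exact hx.2
  have hk2 : 0 < k (2 * s) := hk0 _ (by linarith)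
  have h2 : ∫⁻ x in Set.Ioi (2 * s), D x * ENNReal.ofReal (x ^ q)
      ≤ ENNReal.ofReal (r ^ κ * (K * k (2 * s)) * ((2 * s) ^ (q - κ) / (κ - q))) := by
    calc ∫⁻ x in Set.Ioi (2 * s), D x * ENNReal.ofReal (x ^ q)
        ≤ ∫⁻ x in Set.Ioi (2 * s), ENNReal.ofReal (r ^ κ * (K * k (2 * s))) *
            ENNReal.ofReal (x ^ (q - κ - 1)) := by
          refine setLIntegral_mono' measurableSet_Ioi fun x hx => ?_
          have hx' : 2 * s < x := hx
          have hx0 : 0 < x := by linarith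
          rw [hD, ← ENNReal.ofReal_mul' (by positivity), ← ENNReal.ofReal_mul (by positivity)]
          refine ENNReal.ofReal_le_ofReal ?_
          have h3 : x ^ (q - κ - 1) = x ^ (-κ - 1) * x ^ q := by
            rw [← Real.rpow_add hx0]
            congr 1
            ring
          have h4 := hkK x (2 * s) (by linarith) hx'.le
          rw [h3]
          calc r ^ κ * x ^ (-κ - 1) * k x * x ^ q = r ^ κ * k x * (x ^ (-κ - 1) * x ^ q) := by ring
            _ ≤ _ := by gcongr
      _ = _ := by
          rw [lintegral_const_mul' _ _ (by simp), lintegral_Ioi_rpow (by linarith) (by linarith),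
            ← ENNReal.ofReal_mul (by positivity)]
          congr 3
          · congr 1
            ring
          · ring
  have h3 : ENNReal.ofReal (r ^ κ * ((2 * s) ^ (-κ - 1) * (k (2 * s) / K)) * s)
      ≤ m {x | s < |x|} := by
    rw [hm]
    exact ofReal_le_setLIntegral_Ioi (hq.trans hqκ) hr hK hs (hk0 _ (by linarith)) hkK
  rw [hunion, lintegral_union measurableSet_Ioi hdisj]
  calc _ ≤ ENNReal.ofReal ((2 * s) ^ q) * m {x | s < |x|} +
        ENNReal.ofReal (2 * K ^ 2 / (κ - q) * (2 * s) ^ q) * m {x | s < |x|} := by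
        refine add_le_add h1 (h2.trans ?_)
        refine le_trans (le_of_eq ?_) (mul_le_mul_right h3 _)
        rw [← ENNReal.ofReal_mul (by positivity)]
        congr 1
        have h6 : (2 * s) ^ (-κ - 1) = (2 * s) ^ (q - κ) / ((2 * s) ^ q * (2 * s)) := by
          rw [eq_div_iff (by positivity), ← mul_assoc, ← Real.rpow_add (by positivity)]
          nth_rewrite 2 [← Real.rpow_one (2 * s)]
          rw [← Real.rpow_add (by positivity)]
          congr 1
          ring
        rw [h6]
        have h7 : (2 * s) ^ q ≠ 0 := by positivity
        field_simp
    _ = _ := by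
        rw [← add_mul, ← ENNReal.ofReal_add (by positivity) (by positivity),
          Real.mul_rpow (by norm_num) hs0.le]
        congr 2
        ring

/-- The bound is uniform in `r` because `r ^ κ * r ^ (-κ - 1) * r = 1`; this allows `c_Z = r`. -/
lemma HasPowerTail.le_measure (h : HasPowerTail m κ r N C c K) (hκ : 0 < κ) (hr : 0 < r)
    (hc : 0 < c) (hN : 2 ≤ N) : ENNReal.ofReal (2 ^ (-κ - 1) * c) ≤ m {x | r ≤ |x|} := by
  obtain ⟨k, hden, -, -, hkc, -⟩ := h
  have hm := hden (fun _ => 1) measurable_const r le_rfl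
  simp only [setLIntegral_one, mul_one] at hm
  refine le_trans ?_ (measure_mono (show {x : ℝ | r < |x|} ⊆ {x | r ≤ |x|} from
    Set.ofPred_subset_ofPred.2 fun x hx => hx.le))
  rw [hm]
  calc ENNReal.ofReal (2 ^ (-κ - 1) * c)
      = ∫⁻ x in Set.Ioc r (2 * r), ENNReal.ofReal (r ^ κ * (2 * r) ^ (-κ - 1) * c) := by
        rw [setLIntegral_const, Real.volume_Ioc, ← ENNReal.ofReal_mul (by positivity)]
        congr 1
        have h1 : r ^ κ * r ^ (-κ - 1) * r = 1 := by
          have : 0 < r ^ κ := by positivity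
          rw [Real.rpow_sub_one hr.ne', Real.rpow_neg hr.le]
          field_simp
        rw [Real.mul_rpow (by norm_num) hr.le]
        linear_combination (-(2 : ℝ) ^ (-κ - 1) * c) * h1
    _ ≤ ∫⁻ x in Set.Ioc r (2 * r), ENNReal.ofReal (r ^ κ * x ^ (-κ - 1) * k x) := by
        refine setLIntegral_mono' measurableSet_Ioc fun x hx => ENNReal.ofReal_le_ofReal ?_
        have hx0 : 0 < x := hr.trans hx.1
        have h4 : c ≤ k x := hkc x hx.1.le (hx.2.trans (by gcongr))
        have h5 : (2 * r) ^ (-κ - 1) ≤ x ^ (-κ - 1) :=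
          Real.rpow_le_rpow_of_nonpos hx0 hx.2 (by linarith)
        gcongr
    _ ≤ _ := lintegral_mono_set Set.Ioc_subset_Ioi_self

/-- The tail beyond `D r` is small uniformly in `r`, so any admissible `c_Z` is at most `D r` once
`D` is large in terms of `β₁`. -/
lemma HasPowerTail.measure_le (h : HasPowerTail m κ r N C c K) (hκ : 0 < κ) (hr : 0 < r)
    (hC : 0 < C) {D : ℝ} (hD : 1 ≤ D) :
    m {x | D * r < |x|} ≤ ENNReal.ofReal (C / κ * D ^ (-κ)) := by
  obtain ⟨k, hden, hk0, hkC, -, -⟩ := h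
  have hrD : r ≤ D * r := le_mul_of_one_le_left hr.le hD
  have hm := hden (fun _ => 1) measurable_const (D * r) hrD
  simp only [setLIntegral_one, mul_one] at hm
  rw [hm]
  calc ∫⁻ x in Set.Ioi (D * r), ENNReal.ofReal (r ^ κ * x ^ (-κ - 1) * k x)
      ≤ ∫⁻ x in Set.Ioi (D * r), ENNReal.ofReal (r ^ κ * C) * ENNReal.ofReal (x ^ (-κ - 1)) := by
        refine setLIntegral_mono' measurableSet_Ioi fun x hx => ?_
        have hx' : r ≤ x := hrD.trans (le_of_lt hx)
        have hx0 : 0 < x := hr.trans_le hx'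
        rw [← ENNReal.ofReal_mul (by positivity)]
        refine ENNReal.ofReal_le_ofReal ?_
        rw [mul_right_comm]
        gcongr
        exact hkC x hx'
    _ = _ := by
        rw [lintegral_const_mul' _ _ (by simp), lintegral_Ioi_rpow (by linarith) (by positivity),
          ← ENNReal.ofReal_mul (by positivity)]
        congr 1
        have h1 : -κ - 1 + 1 = -κ := by ring
        have h2 : r ^ κ * r ^ (-κ) = 1 := by
          rw [← Real.rpow_add hr]
          simp
        rw [h1, Real.mul_rpow (by linarith) hr.le, neg_neg]
        linear_combination (C / κ * D ^ (-κ)) * h2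

/-- At the critical order `κ` the weighted density is at least a multiple of `1 / x` on `(D r, N
r]`, and this integrates to a logarithm. -/
lemma HasPowerTail.log_le_lintegral (h : HasPowerTail m κ r N C c K) (hr : 0 < r)
    (hc : 0 < c) {D : ℝ} (hD : 1 ≤ D) (hN : D ≤ N) :
    ENNReal.ofReal (r ^ κ * c * Real.log (N / D))
      ≤ ∫⁻ x in {x | D * r < |x|}, ENNReal.ofReal (|x| ^ κ) ∂m := by
  obtain ⟨k, hden, hk0, -, hkc, -⟩ := h
  have hrD : r ≤ D * r := le_mul_of_one_le_left hr.le hD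
  have hD0 : 0 < D * r := hr.trans_le hrD
  have hDN : D * r ≤ N * r := by gcongr
  rw [hden (fun x => ENNReal.ofReal (x ^ κ)) (by fun_prop) _ hrD]
  have h0 : (0 : ℝ) ∉ Set.uIcc (D * r) (N * r) := by
    rw [Set.uIcc_of_le hDN]
    exact fun h => absurd h.1 (not_le.2 hD0)
  have hint : ENNReal.ofReal (Real.log (N / D))
      = ∫⁻ x in Set.Ioc (D * r) (N * r), ENNReal.ofReal x⁻¹ := by
    rw [← ofReal_integral_eq_lintegral_ofReal]
    · rw [← intervalIntegral.integral_of_le hDN, integral_inv h0, mul_div_mul_right _ _ hr.ne']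
    · exact (intervalIntegrable_iff_integrableOn_Ioc_of_le hDN).1
        (intervalIntegral.intervalIntegrable_inv (fun x hx hx0 => h0 (hx0 ▸ hx)) continuousOn_id)
    · filter_upwards [ae_restrict_mem measurableSet_Ioc] with x hx
      exact inv_nonneg.2 (hD0.trans hx.1).le
  rw [ENNReal.ofReal_mul (by positivity), hint, ← lintegral_const_mul' _ _ (by simp)]
  refine (setLIntegral_mono' measurableSet_Ioc fun x hx => ?_).trans
    (lintegral_mono_set Set.Ioc_subset_Ioi_self)
  have hx0 : 0 < x := hD0.trans hx.1
  rw [← ENNReal.ofReal_mul (by positivity), ← ENNReal.ofReal_mul' (by positivity)]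
  refine ENNReal.ofReal_le_ofReal ?_
  have h1 : x ^ (-κ - 1) * x ^ κ = x⁻¹ := by
    rw [← Real.rpow_add hx0, ← Real.rpow_neg_one]
    congr 1
    ring
  have h2 : r ^ κ * x ^ (-κ - 1) * k x * x ^ κ = r ^ κ * k x * x⁻¹ := by
    rw [← h1]
    ring
  rw [h2]
  gcongr
  exact hkc x (hrD.trans hx.1.le) hx.2

lemma HasPowerTail.measure_pos (h : HasPowerTail m κ r N C c K) (hκ : 0 < κ) (hr : 0 < r)
    (hK : 0 < K) (s : ℝ) : 0 < m {x | s < |x|} := by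
  obtain ⟨k, hden, hk0, -, -, hkK⟩ := h
  have hm := hden (fun _ => 1) measurable_const (max s r) (le_max_right _ _)
  simp only [setLIntegral_one, mul_one] at hm
  have hmr : r ≤ max s r := le_max_right _ _
  have hm0 : 0 < max s r := hr.trans_le hmr
  have hk2 : 0 < k (2 * max s r) := hk0 _ (by linarith)
  refine lt_of_lt_of_le ?_ (measure_mono (show {x : ℝ | max s r < |x|} ⊆ {x | s < |x|} from
    Set.ofPred_subset_ofPred.2 fun x hx => (le_max_left _ _).trans_lt hx))
  rw [hm]
  refine lt_of_lt_of_le ?_ (ofReal_le_setLIntegral_Ioi hκ hr hK hmr hk2 hkK)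
  rw [ENNReal.ofReal_pos]
  positivity

end PowerTail

/-- Condition `C_q` for a collection of random variables with power tails of index `κ`. -/
theorem satisfiesC_iff_of_hasPowerTail {Ω I : Type*} [MeasurableSpace Ω] {P : Measure Ω}
    [IsProbabilityMeasure P] {𝓗 : I → Set (Ω → ℝ)} {t₀ κ C c K : ℝ} {r : ℝ → ℝ} (ht₀ : 0 < t₀)
    (hκ : 0 < κ) (hC : 0 < C) (hc : 0 < c) (hK : 0 < K) (hr : ∀ a, 0 < a → 0 < r a)
    (h1 : ∀ ξ, ∀ Z ∈ 𝓗 ξ, Measurable Z ∧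
      ∃ a, 0 < a ∧ a ≤ t₀ ∧ HasPowerTail (P.map Z) κ (r a) (2 * t₀ / a) C c K)
    (h2 : ∀ a, 0 < a → a ≤ t₀ → ∃ ξ, ∃ Z ∈ 𝓗 ξ,
      HasPowerTail (P.map Z) κ (r a) (2 * t₀ / a) C c K)
    {q : ℝ≥0∞} (hq : 0 < q) : SatisfiesC P 𝓗 q ↔ q < ENNReal.ofReal κ := by
  have hset : ∀ s : ℝ, MeasurableSet {x : ℝ | s < |x|} := fun s => by measurability
  have hmap : ∀ Z : Ω → ℝ, Measurable Z → ∀ s, P {ω | s < |Z ω|} = P.map Z {x | s < |x|} :=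
    fun Z hZ s => (Measure.map_apply hZ (hset s)).symm
  have hmapq : ∀ Z : Ω → ℝ, Measurable Z → ∀ s q : ℝ,
      ∫⁻ ω in {ω | s < |Z ω|}, ENNReal.ofReal (|Z ω| ^ q) ∂P
        = ∫⁻ x in {x | s < |x|}, ENNReal.ofReal (|x| ^ q) ∂(P.map Z) := by
    intro Z hZ s q
    rw [setLIntegral_map (hset s) (by fun_prop) hZ]
    rfl
  constructor
  · rintro ⟨htop, hfin⟩
    by_contra hcon
    rw [not_lt] at hcon
    by_cases hqt : q = ∞
    · obtain ⟨-, β, hβ⟩ := htop hqt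
      obtain ⟨ξ, Z, hZ, htail⟩ := h2 t₀ ht₀ le_rfl
      have hZm := (h1 ξ Z hZ).1
      set M := ∫ ω, Z ω ∂P
      have hess := (hβ ξ Z hZ).1
      rw [eLpNorm_exponent_top] at hess
      have hae := ae_le_eLpNormEssSup (f := fun ω => Z ω - M) (μ := P)
      have h3 := htail.measure_pos hκ (hr _ ht₀) hK
        ((eLpNormEssSup (fun ω => Z ω - M) P).toReal + |M|)
      rw [← hmap Z hZm] at h3
      refine h3.ne' (measure_mono_null (fun ω hω => ?_) (ae_iff.1 hae))
      have hω' : (eLpNormEssSup (fun ω => Z ω - M) P).toReal + |M| < |Z ω| := hω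
      intro hle
      have h4 := ENNReal.toReal_mono hess hle
      rw [toReal_enorm, Real.norm_eq_abs] at h4
      have h5 := abs_sub_abs_le_abs_sub (Z ω) M
      linarith
    -- By monotonicity in the order it is enough to refute the critical case `κ`.
    · have hκq : κ ≤ q.toReal := by
        rwa [ENNReal.ofReal_le_iff_le_toReal hqt] at hcon
      obtain ⟨β₁, β₂, hβ₁, hβ₂, hβ⟩ := (hfin hqt).mono hκq fun ξ Z hZ => (h1 ξ Z hZ).1
      obtain ⟨D, hD1, hD⟩ : ∃ D : ℝ, 1 ≤ D ∧ C / κ * D ^ (-κ) < β₁ := by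
        have h3 : Tendsto (fun D : ℝ => C / κ * D ^ (-κ)) atTop (𝓝 (C / κ * 0)) :=
          (tendsto_rpow_neg_atTop hκ).const_mul _
        rw [mul_zero] at h3
        exact ((eventually_ge_atTop 1).and (h3.eventually_lt_const hβ₁)).exists
      have hD0 : 0 < D := by linarith
      obtain ⟨x, hxD, hx⟩ : ∃ x : ℝ, max 2 D < x ∧ β₂ * D ^ κ < c * Real.log (x / D) := by
        have h3 : Tendsto (fun x : ℝ => c * Real.log (x / D)) atTop atTop :=
          (Real.tendsto_log_atTop.comp (tendsto_id.atTop_div_const hD0)).const_mul_atTop hc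
        exact ((eventually_gt_atTop _).and (h3.eventually_gt_atTop _)).exists
      have hx2 : 2 < x := (le_max_left _ _).trans_lt hxD
      -- The time `a` is chosen so that the power window `2 * t₀ / a` equals `x`, which makes the
      -- logarithm beat `β₂ * D ^ κ`.
      set a := 2 * t₀ / x with ha
      have ha0 : 0 < a := by positivity
      have hat : a ≤ t₀ := by
        rw [ha, div_le_iff₀ (by positivity)]
        nlinarith
      have hax : 2 * t₀ / a = x := by
        rw [ha, div_div_cancel₀ (by positivity)]
      obtain ⟨ξ, Z, hZ, htail⟩ := h2 a ha0 hat
      rw [hax] at htail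
      have hZm := (h1 ξ Z hZ).1
      have hra := hr a ha0
      obtain ⟨b, hb, hbP, hbs⟩ := hβ ξ Z hZ
      have hbD : b ≤ D * r a := by
        by_contra hcon'
        rw [not_le] at hcon'
        have h3 : P {ω | b ≤ |Z ω|} ≤ P {ω | D * r a < |Z ω|} :=
          measure_mono (Set.ofPred_subset_ofPred.2 fun ω hω => hcon'.trans_le hω)
        have h4 := hbP.trans (h3.trans ((hmap Z hZm _).le.trans (htail.measure_le hκ hra hC hD1)))
        rw [ENNReal.ofReal_le_ofReal_iff (by positivity)] at h4
        linarith
      have h3 := hbs (D * r a) hbD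
      rw [hmapq Z hZm] at h3
      -- With the tail probability bounded by one, `r a ^ κ` cancels on both sides and leaves `c *
      -- log (x / D) ≤ β₂ * D ^ κ`.
      have h4 := (htail.log_le_lintegral hra hc hD1 ((le_max_right _ _).trans hxD.le)).trans
        (h3.trans (mul_le_of_le_one_right (zero_le) prob_le_one))
      rw [ENNReal.ofReal_le_ofReal_iff (by positivity), Real.mul_rpow hD0.le hra.le] at h4
      have h5 : 0 < r a ^ κ := by positivity
      nlinarith
  · intro hqκ
    refine ⟨fun h => absurd h (hqκ.trans_le le_top).ne, fun hqt => ?_⟩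
    have hq0 : 0 < q.toReal := ENNReal.toReal_pos hq.ne' hqt
    have hqκ' : q.toReal < κ := by
      rwa [ENNReal.lt_ofReal_iff_toReal_lt hqt] at hqκ
    refine ⟨2 ^ (-κ - 1) * c, 2 ^ q.toReal * (1 + 2 * K ^ 2 / (κ - q.toReal)), by positivity,
      ?_, fun ξ Z hZ => ?_⟩
    · have : 0 < κ - q.toReal := sub_pos.2 hqκ'
      positivity
    · obtain ⟨hZm, a, ha, hat, htail⟩ := h1 ξ Z hZ
      have hra := hr a ha
      refine ⟨r a, hra, ?_, fun s hs => ?_⟩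
      · refine (htail.le_measure hκ hra hc ?_).trans (le_of_eq ?_)
        · rw [le_div_iff₀ ha]
          linarith
        · exact Measure.map_apply hZm (by measurability)
      · rw [hmapq Z hZm, hmap Z hZm]
        exact htail.lintegral_rpow_le hra hK hq0 hqκ' hs

/-! ### Tails of the inverse Gaussian and normal inverse Gaussian distributions -/

/-- The prefactor is `a x ^ (-3/2)`, so `κ = 1/2` and `r = a²`, and `k` is the exponential factor.
Its exponent involves `(x - aμ)² / x = x - 2aμ + a²μ² / x`. The first term increases, and the last
lies in `[0, μ²]` for `x ≥ a²`, which gives `K = exp (l / 2)`. Up to `N r = 2 t₀ a ≤ 2 t₀²` the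
expression is at most `2 t₀² + μ²`, which gives `c`. -/
lemma hasPowerTail_inverseGaussian {μ l t₀ a : ℝ} (hμ : 0 < μ) (hl : 0 < l) (ha : 0 < a) (hat : a ≤ t₀) :
    HasPowerTail (inverseGaussian (a * μ) (a ^ 2 * l)) (1 / 2) (a ^ 2) (2 * t₀ / a)
      (Real.sqrt (l / (2 * Real.pi)))
      (Real.sqrt (l / (2 * Real.pi)) * Real.exp (-(l * (2 * t₀ ^ 2 + μ ^ 2) / (2 * μ ^ 2))))
      (Real.exp (l / 2)) := by
  have ha2 : 0 < a ^ 2 := by positivity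
  refine ⟨fun x => Real.sqrt (l / (2 * Real.pi)) *
    Real.exp (-(l * ((x - a * μ) ^ 2 / x) / (2 * μ ^ 2))), ?_, ?_, ?_, ?_, ?_⟩
  · intro F hF s hs
    have hs0 : 0 < s := ha2.trans_le hs
    have hset : MeasurableSet {x : ℝ | s < |x|} := by measurability
    rw [← lintegral_indicator hset, lintegral_inverseGaussian _ _
      (Measurable.indicator (by fun_prop) hset), ← lintegral_indicator measurableSet_Ioi,
      ← lintegral_indicator measurableSet_Ioi]
    refine lintegral_congr fun x => ?_
    by_cases hx : s < x
    · have hx0 : 0 < x := hs0.trans hx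
      have hxa : s < |x| := by rwa [abs_of_pos hx0]
      rw [Set.indicator_of_mem (show x ∈ Set.Ioi 0 from hx0),
        Set.indicator_of_mem (show x ∈ Set.Ioi s from hx), Set.indicator_of_mem (by exact hxa),
        abs_of_pos hx0]
      congr 2
      rw [inverseGaussianPDF, ← mul_assoc]
      congr 1
      · have h1 : (a ^ 2) ^ (1 / 2 : ℝ) = a := by
          rw [← Real.sqrt_eq_rpow, Real.sqrt_sq ha.le]
        have h2 : x ^ (-(1 / 2) - 1 : ℝ) = Real.sqrt ((x ^ 3)⁻¹) := by
          rw [Real.sqrt_eq_rpow, ← Real.rpow_natCast, ← Real.rpow_neg hx0.le,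
            ← Real.rpow_mul hx0.le]
          norm_num
        have h3 : a ^ 2 * l / (2 * Real.pi * x ^ 3) = a ^ 2 * ((x ^ 3)⁻¹ * (l / (2 * Real.pi))) := by
          field_simp
        rw [h1, h2, h3, Real.sqrt_mul (by positivity), Real.sqrt_sq ha.le,
          Real.sqrt_mul (by positivity), mul_assoc]
      · congr 1
        field_simp
    · rw [Set.indicator_of_notMem (show x ∉ Set.Ioi s from hx)]
      by_cases hx0 : 0 < x
      · rw [Set.indicator_of_mem (show x ∈ Set.Ioi 0 from hx0), Set.indicator_of_notMem, mul_zero]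
        intro h
        have h' : s < |x| := h
        rw [abs_of_pos hx0] at h'
        exact hx h'
      · rw [Set.indicator_of_notMem (show x ∉ Set.Ioi 0 from hx0)]
  · intro x hx
    positivity
  · intro x hx
    have hx0 : 0 < x := ha2.trans_le hx
    refine mul_le_of_le_one_right (by positivity) (Real.exp_le_one_iff.2 ?_)
    have : 0 ≤ l * ((x - a * μ) ^ 2 / x) / (2 * μ ^ 2) := by positivity
    linarith
  · intro x hx hxN
    have hx0 : 0 < x := ha2.trans_le hx
    have h1 : (x - a * μ) ^ 2 / x ≤ 2 * t₀ ^ 2 + μ ^ 2 := by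
      have h2 : 2 * t₀ / a * a ^ 2 = 2 * t₀ * a := by
        field_simp
      have h3 : x ≤ 2 * t₀ ^ 2 := by nlinarith
      have h4 : x * x ≤ 2 * t₀ ^ 2 * x := by gcongr
      have h5 : a ^ 2 * μ ^ 2 ≤ x * μ ^ 2 := by gcongr
      have h6 : 0 < a * μ * x := by positivity
      rw [div_le_iff₀ hx0]
      linarith
    dsimp only
    gcongr
  · intro x y hy hyx
    have hy0 : 0 < y := ha2.trans_le hy
    have hx0 : 0 < x := hy0.trans_le hyx
    dsimp only
    rw [mul_left_comm, ← Real.exp_add]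
    gcongr
    have h1 : ∀ z : ℝ, 0 < z → (z - a * μ) ^ 2 / z = z - 2 * a * μ + a ^ 2 * μ ^ 2 / z := by
      intro z hz
      field_simp
      ring
    have h2 : (y - a * μ) ^ 2 / y ≤ (x - a * μ) ^ 2 / x + μ ^ 2 := by
      have h3 : a ^ 2 * μ ^ 2 / y ≤ μ ^ 2 := by
        rw [div_le_iff₀ hy0, mul_comm]
        gcongr
      have h4 : 0 ≤ a ^ 2 * μ ^ 2 / x := by positivity
      rw [h1 y hy0, h1 x hx0]
      linarith
    have h3 : l * ((y - a * μ) ^ 2 / y) / (2 * μ ^ 2) ≤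
        l * ((x - a * μ) ^ 2 / x + μ ^ 2) / (2 * μ ^ 2) := by gcongr
    have h4 : l * ((x - a * μ) ^ 2 / x + μ ^ 2) / (2 * μ ^ 2)
        = l * ((x - a * μ) ^ 2 / x) / (2 * μ ^ 2) + l / 2 := by
      field_simp
    linarith

lemma measurable_ofReal_symmetricNIGPDF {α δ : ℝ} (hα : 0 < α) (hδ : 0 < δ) :
    Measurable fun x => ENNReal.ofReal (symmetricNIGPDF α δ x) := by
  have hmeas : Measurable (Function.uncurry fun x w : ℝ =>
      ENNReal.ofReal (inverseGaussianPDF (δ / α) (δ ^ 2) w) *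
        ENNReal.ofReal (normalKernel w x)) := by
    unfold inverseGaussianPDF normalKernel Function.uncurry
    fun_prop
  simp_rw [ofReal_symmetricNIGPDF hα hδ]
  exact Measurable.lintegral_prod_right hmeas

lemma setLIntegral_lt_abs {f : ℝ → ℝ≥0∞} (hf : ∀ x, f (-x) = f x) {s : ℝ} (hs : 0 ≤ s) :
    ∫⁻ x in {x | s < |x|}, f x = 2 * ∫⁻ x in Set.Ioi s, f x := by
  have h1 : {x : ℝ | s < |x|} = Set.Iio (-s) ∪ Set.Ioi s := by
    ext x
    simp only [Set.mem_union, Set.mem_Iio, Set.mem_Ioi]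
    change s < |x| ↔ _
    rw [lt_abs, or_comm, lt_neg]
  have h2 : Disjoint (Set.Iio (-s)) (Set.Ioi s) := by
    rw [Set.disjoint_left]
    intro x hx hx'
    have h3 : x < -s := hx
    have h4 : s < x := hx'
    linarith
  have h3 : ∫⁻ x in Set.Iio (-s), f x = ∫⁻ x in Set.Ioi s, f x := by
    have h4 := (Measure.measurePreserving_neg (volume : Measure ℝ)).setLIntegral_comp_preimage_emb
      (MeasurableEquiv.neg ℝ).measurableEmbedding f (Set.Ioi s)
    rw [← h4]
    simp [hf]
  rw [h1, lintegral_union measurableSet_Ioi h2, h3, two_mul]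

/-- With `R² = (aδ)² + x²` and `K₁(z) = besselTail z / z`, the density of `|x|` is a multiple of `a
R⁻² besselTail (α R)`, so `κ = 1` and `r = a`. The ratio `x² / R²` lies between `1 / (1 + δ²)` and
`1` for `x ≥ a`, and `besselTail` is positive, decreasing and at most one. -/
lemma hasPowerTail_symmetricNIG {α δ t₀ a : ℝ} (hα : 0 < α) (hδ : 0 < δ) (ha : 0 < a)
    (hat : a ≤ t₀) :
    HasPowerTail (symmetricNIG α (a * δ)) 1 a (2 * t₀ / a)
      (2 * δ * Real.exp (t₀ * δ * α) / Real.pi)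
      (2 * δ / Real.pi * ((1 + δ ^ 2)⁻¹ *
        besselTail (α * Real.sqrt ((t₀ * δ) ^ 2 + (2 * t₀) ^ 2))))
      (1 + δ ^ 2) := by
  have ht₀ : 0 < t₀ := ha.trans_le hat
  set z : ℝ → ℝ := fun x => α * Real.sqrt ((a * δ) ^ 2 + x ^ 2) with hz
  have hz0 : ∀ x, 0 < z x := fun x => by positivity
  have hzmono : ∀ x y, 0 ≤ y → y ≤ x → z y ≤ z x := fun x y hy hyx => by
    simp only [hz]
    gcongr
  have hfrac : ∀ x, a ≤ x → (1 + δ ^ 2)⁻¹ ≤ x ^ 2 / ((a * δ) ^ 2 + x ^ 2) := by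
    intro x hx
    have hx0 : 0 < x := ha.trans_le hx
    rw [inv_le_comm₀ (by positivity) (by positivity), inv_div, div_le_iff₀ (by positivity), mul_pow]
    have : a ^ 2 * δ ^ 2 ≤ x ^ 2 * δ ^ 2 := by gcongr
    linarith
  have hfrac' : ∀ x, x ^ 2 / ((a * δ) ^ 2 + x ^ 2) ≤ 1 := by
    intro x
    rw [div_le_one (by positivity)]
    have : 0 ≤ (a * δ) ^ 2 := by positivity
    linarith
  refine ⟨fun x => 2 * δ * Real.exp (a * δ * α) / Real.pi *
    (x ^ 2 / ((a * δ) ^ 2 + x ^ 2) * besselTail (z x)), ?_, ?_, ?_, ?_, ?_⟩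
  · intro F hF s hs
    have hs0 : 0 < s := ha.trans_le hs
    have hset : MeasurableSet {x : ℝ | s < |x|} := by measurability
    have hdef : symmetricNIG α (a * δ) = volume.withDensity fun x =>
      ENNReal.ofReal (symmetricNIGPDF α (a * δ) x) := rfl
    have hmeas := measurable_ofReal_symmetricNIGPDF hα (mul_pos ha hδ)
    rw [hdef, setLIntegral_withDensity_eq_setLIntegral_mul _ hmeas (by fun_prop) hset,
      setLIntegral_lt_abs _ hs0.le, ← lintegral_const_mul' _ _ (by simp)]
    · refine setLIntegral_congr_fun measurableSet_Ioi fun x hx => ?_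
      have hx0 : 0 < x := hs0.trans hx
      have h2 : (2 : ℝ≥0∞) = ENNReal.ofReal 2 := by simp
      rw [Pi.mul_apply, abs_of_pos hx0, ← mul_assoc, h2, ← ENNReal.ofReal_mul (by norm_num)]
      congr 2
      set R := Real.sqrt ((a * δ) ^ 2 + x ^ 2) with hR
      have hR0 : 0 < R := Real.sqrt_pos.2 (by positivity)
      have hRR : R ^ 2 = (a * δ) ^ 2 + x ^ 2 := Real.sq_sqrt (by positivity)
      have hS : Real.sqrt (1 + x ^ 2 / (a * δ) ^ 2) = R / (a * δ) := by
        rw [← Real.sqrt_sq (show 0 ≤ R / (a * δ) by positivity), div_pow, hRR]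
        congr 1
        field_simp
      have hzx : a * δ * α * (R / (a * δ)) = z x := by
        simp only [hz, ← hR]
        field_simp
      have hK : besselK1 (z x) = besselTail (z x) / (α * R) := by
        rw [← mul_besselK1 (hz0 x)]
        simp only [hz, ← hR]
        field_simp
      have hp : x ^ (-1 - 1 : ℝ) = (x ^ 2)⁻¹ := by
        rw [← Real.rpow_natCast, ← Real.rpow_neg hx0.le]
        norm_num
      beta_reduce
      rw [symmetricNIGPDF, hS, hzx, hK, ← hRR, hp, Real.rpow_one]
      field_simp
    · intro x
      simp only [Pi.mul_apply, symmetricNIGPDF, neg_sq, abs_neg]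
  · intro x hx
    have hx0 : 0 < x := ha.trans_le hx
    have := besselTail_pos (z x)
    positivity
  · intro x hx
    have h1 := besselTail_le_one (hz0 x).le
    have h2 := (besselTail_pos (z x)).le
    have h3 : Real.exp (a * δ * α) ≤ Real.exp (t₀ * δ * α) := by gcongr
    have h4 := mul_le_one₀ (hfrac' x) h2 h1
    calc _ ≤ 2 * δ * Real.exp (a * δ * α) / Real.pi := mul_le_of_le_one_right (by positivity) h4
      _ ≤ _ := by gcongr
  · intro x hx hxN
    have hx0 : 0 < x := ha.trans_le hx
    rw [div_mul_cancel₀ _ ha.ne'] at hxN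
    have h1 : z x ≤ α * Real.sqrt ((t₀ * δ) ^ 2 + (2 * t₀) ^ 2) := by
      simp only [hz]
      gcongr
    have h2 := antitoneOn_besselTail (hz0 x).le ((hz0 x).le.trans h1) h1
    have h3 := hfrac x hx
    have h4 : 1 ≤ Real.exp (a * δ * α) := Real.one_le_exp (by positivity)
    have h5 := (besselTail_pos (α * Real.sqrt ((t₀ * δ) ^ 2 + (2 * t₀) ^ 2))).le
    have h6 : 2 * δ ≤ 2 * δ * Real.exp (a * δ * α) := le_mul_of_one_le_right (by positivity) h4
    dsimp only
    gcongr
  · intro x y hy hyx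
    have hy0 : 0 < y := ha.trans_le hy
    have h2 := antitoneOn_besselTail (hz0 y).le (hz0 x).le (hzmono x y hy0.le hyx)
    have h3 := hfrac y hy
    rw [inv_le_iff_one_le_mul₀' (by positivity)] at h3
    have h5 := (besselTail_pos (z y)).le
    have h6 := (besselTail_pos (z x)).le
    have h7 : x ^ 2 / ((a * δ) ^ 2 + x ^ 2) * besselTail (z x) ≤
        (1 + δ ^ 2) * (y ^ 2 / ((a * δ) ^ 2 + y ^ 2)) * besselTail (z y) := by
      refine mul_le_mul ((hfrac' x).trans h3) h2 h6 (by positivity)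
    dsimp only
    calc _ ≤ 2 * δ * Real.exp (a * δ * α) / Real.pi *
          ((1 + δ ^ 2) * (y ^ 2 / ((a * δ) ^ 2 + y ^ 2)) * besselTail (z y)) := by gcongr
      _ = _ := by ring

/-! ### The collection induced by a Lévy process -/

section Induced

variable {Ω : Type*} [MeasurableSpace Ω] {P : Measure Ω} [IsProbabilityMeasure P] {t₀ : ℝ}
  {Y : Set.Icc (0 : ℝ) t₀ → Ω → ℝ} {Λ : Set ℝ → Ω → ℝ}

lemma exists_law_of_mem_inducedFamily (hY : IsLevyProcess P Y) (h₀ : 0 ≤ t₀)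
    (hΛ : IsInducedRandomMeasure P Y Λ) (ξ : borelFamilies t₀) {Z : Ω → ℝ}
    (hZ : Z ∈ inducedFamily t₀ Λ ξ) :
    Measurable Z ∧ ∃ a, 0 < a ∧ a ≤ t₀ ∧ P.map Z = levyLaw P h₀ Y a := by
  obtain ⟨A, hA, rfl⟩ := hZ
  obtain ⟨hAm, hAs, hA0⟩ := ξ.2.2.2.2 A hA
  have hfin : volume A ≠ ∞ := ((measure_mono hAs).trans_lt (by simp)).ne
  refine ⟨(hΛ A hAm hAs).1, volume.real A, ENNReal.toReal_pos hA0.ne' hfin, ?_,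
    hY.map_eq_of_isIntegralOver hAm hAs (hΛ A hAm hAs)⟩
  refine (measureReal_mono hAs (by simp)).trans ?_
  simp [h₀]

/-- Every time `a` is realised by the single set `(0, a]`. -/
lemma exists_mem_inducedFamily (hY : IsLevyProcess P Y) (h₀ : 0 ≤ t₀)
    (hΛ : IsInducedRandomMeasure P Y Λ) {a : ℝ} (ha : 0 < a) (hat : a ≤ t₀) :
    ∃ ξ, ∃ Z ∈ inducedFamily t₀ Λ ξ, P.map Z = levyLaw P h₀ Y a := by
  have hs : Set.Ioc 0 a ⊆ Set.Icc 0 t₀ := fun x hx => ⟨hx.1.le, hx.2.trans hat⟩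
  have hξ : {Set.Ioc 0 a} ∈ borelFamilies t₀ := by
    refine ⟨Set.finite_singleton _, Set.singleton_nonempty _, Set.pairwiseDisjoint_singleton _ _, ?_⟩
    rintro A rfl
    exact ⟨measurableSet_Ioc, hs, by simpa using ha⟩
  refine ⟨⟨_, hξ⟩, Λ (Set.Ioc 0 a), ⟨_, rfl, rfl⟩, ?_⟩
  rw [hY.map_eq_of_isIntegralOver (h₀ := h₀) measurableSet_Ioc hs (hΛ _ measurableSet_Ioc hs)]
  simp [ha.le]

theorem satisfiesC_iff_of_inverseGaussian (hY : IsLevyProcess P Y) (ht₀ : 1 ≤ t₀)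
    (hΛ : IsInducedRandomMeasure P Y Λ) {μ l : ℝ} (hμ : 0 < μ) (hl : 0 < l)
    (h1 : P.map (Y ⟨1, zero_le_one, ht₀⟩) = inverseGaussian μ l) {q : ℝ≥0∞} (hq : 0 < q) :
    SatisfiesC P (inducedFamily t₀ Λ) q ↔ q < 1 / 2 := by
  have h₀ : 0 < t₀ := by linarith
  have hlaw : levyLaw P h₀.le Y 1 = inverseGaussian μ l :=
    (levyLaw_coe (h₀ := h₀.le) ⟨1, zero_le_one, ht₀⟩).trans h1
  have htail : ∀ {a}, 0 < a → a ≤ t₀ → HasPowerTail (levyLaw P h₀.le Y a) _ _ _ _ _ _ :=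
    fun {a} ha hat => by
      rw [hY.levyLaw_eq_inverseGaussian ht₀ hμ hl hlaw ha hat]
      exact hasPowerTail_inverseGaussian hμ hl ha hat
  have hhalf : ENNReal.ofReal (1 / 2) = 1 / 2 := by
    rw [ENNReal.ofReal_div_of_pos (by norm_num)]
    simp
  rw [← hhalf]
  refine satisfiesC_iff_of_hasPowerTail (r := fun a => a ^ 2) h₀ (by norm_num) ?_ ?_ ?_
    (fun a ha => by positivity) (fun ξ Z hZ => ?_) (fun a ha hat => ?_) hq
    (C := Real.sqrt (l / (2 * Real.pi)))
    (c := Real.sqrt (l / (2 * Real.pi)) * Real.exp (-(l * (2 * t₀ ^ 2 + μ ^ 2) / (2 * μ ^ 2))))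
    (K := Real.exp (l / 2))
  · positivity
  · positivity
  · positivity
  · obtain ⟨hZm, a, ha, hat, hZa⟩ := exists_law_of_mem_inducedFamily hY h₀.le hΛ ξ hZ
    exact ⟨hZm, a, ha, hat, hZa ▸ htail ha hat⟩
  · obtain ⟨ξ, Z, hZ, hZa⟩ := exists_mem_inducedFamily hY h₀.le hΛ ha hat
    exact ⟨ξ, Z, hZ, hZa ▸ htail ha hat⟩

theorem satisfiesC_iff_of_symmetricNIG (hY : IsLevyProcess P Y) (ht₀ : 1 ≤ t₀)
    (hΛ : IsInducedRandomMeasure P Y Λ) {α δ : ℝ} (hα : 0 < α) (hδ : 0 < δ)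
    (h1 : P.map (Y ⟨1, zero_le_one, ht₀⟩) = symmetricNIG α δ) {q : ℝ≥0∞} (hq : 0 < q) :
    SatisfiesC P (inducedFamily t₀ Λ) q ↔ q < 1 := by
  have h₀ : 0 < t₀ := by linarith
  have hlaw : levyLaw P h₀.le Y 1 = symmetricNIG α δ :=
    (levyLaw_coe (h₀ := h₀.le) ⟨1, zero_le_one, ht₀⟩).trans h1
  have htail : ∀ {a}, 0 < a → a ≤ t₀ → HasPowerTail (levyLaw P h₀.le Y a) _ _ _ _ _ _ :=
    fun {a} ha hat => by
      rw [hY.levyLaw_eq_symmetricNIG ht₀ hα hδ hlaw ha hat]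
      exact hasPowerTail_symmetricNIG hα hδ ha hat
  rw [← ENNReal.ofReal_one]
  refine satisfiesC_iff_of_hasPowerTail (r := fun a => a) h₀ one_pos ?_ ?_ ?_
    (fun a ha => ha) (fun ξ Z hZ => ?_) (fun a ha hat => ?_) hq
    (C := 2 * δ * Real.exp (t₀ * δ * α) / Real.pi)
    (c := 2 * δ / Real.pi * ((1 + δ ^ 2)⁻¹ *
        besselTail (α * Real.sqrt ((t₀ * δ) ^ 2 + (2 * t₀) ^ 2))))
    (K := 1 + δ ^ 2)
  · positivity
  · have := besselTail_pos (α * Real.sqrt ((t₀ * δ) ^ 2 + (2 * t₀) ^ 2))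
    positivity
  · positivity
  · obtain ⟨hZm, a, ha, hat, hZa⟩ := exists_law_of_mem_inducedFamily hY h₀.le hΛ ξ hZ
    exact ⟨hZm, a, ha, hat, hZa ▸ htail ha hat⟩
  · obtain ⟨ξ, Z, hZ, hZa⟩ := exists_mem_inducedFamily hY h₀.le hΛ ha hat
    exact ⟨ξ, Z, hZ, hZa ▸ htail ha hat⟩

end Induced

/-! ### Small-time behaviour of Lévy processes without Gaussian component -/

lemma norm_exp_mul_I_sub_one_sub_le (y : ℝ) :
    ‖Complex.exp (Complex.I * y) - 1‖ ≤ 2 ∧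
    ‖Complex.exp (Complex.I * y) - 1 - Complex.I * y‖ ≤ 2 + |y| ∧
    ‖Complex.exp (Complex.I * y) - 1 - Complex.I * y‖ ≤ 3 * y ^ 2 := by
  have h0 : ‖Complex.exp (Complex.I * y)‖ = 1 := by
    rw [mul_comm]
    exact Complex.norm_exp_ofReal_mul_I y
  have hy : ‖Complex.I * (y : ℂ)‖ = |y| := by simp
  have h1 : ‖Complex.exp (Complex.I * y) - 1‖ ≤ 2 := by
    refine (norm_sub_le _ _).trans ?_
    rw [h0]
    norm_num
  have h2 : ‖Complex.exp (Complex.I * y) - 1 - Complex.I * y‖ ≤ 2 + |y| := by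
    refine (norm_sub_le _ _).trans ?_
    rw [hy]
    linarith
  refine ⟨h1, h2, ?_⟩
  rw [← sq_abs y]
  rcases le_or_gt |y| 1 with h | h
  · have h3 := Complex.norm_exp_sub_one_sub_id_le (x := Complex.I * y) (by rwa [hy])
    rw [hy] at h3
    nlinarith [sq_nonneg |y|]
  · nlinarith

lemma IsLevyMeasure.integrable_min {ν : Measure ℝ} (hν : IsLevyMeasure ν) :
    Integrable (fun x : ℝ => min 1 (x ^ 2)) ν := by
  refine ⟨Measurable.aestronglyMeasurable (by fun_prop), ?_⟩
  rw [hasFiniteIntegral_iff_ofReal (Eventually.of_forall fun x => by positivity)]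
  exact hν.2

/-- Without Gaussian part, the Lévy–Khintchine exponent is `o(u ^ 2)` at infinity. -/
lemma eventually_mul_norm_levyExponent_le {b : ℝ} {ν : Measure ℝ} (hν : IsLevyMeasure ν) {U ε : ℝ}
    (hU : 0 ≤ U) (hε : 0 < ε) :
    ∀ᶠ t in 𝓝[>] (0 : ℝ), ∀ w : ℝ, |w| * Real.sqrt t ≤ U → t * ‖levyExponent b 0 ν w‖ ≤ ε := by
  -- `g t x` dominates `t` times the Lévy–Khintchine integrand whenever `|w| √t ≤ U`. The first
  -- entry of the minimum gives a bound integrable uniformly in `t`, the second gives pointwise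
  -- convergence to zero, so dominated convergence applies. A Gaussian term `t v w² / 2` would only
  -- stay bounded.
  let g : ℝ → ℝ → ℝ := fun t x =>
    if |x| ≤ 1 then min (3 * U ^ 2 * x ^ 2) (2 * t + Real.sqrt t * (U * |x|)) else 2 * t
  have hgm : ∀ t, Measurable (g t) := by
    intro t
    refine Measurable.ite (measurableSet_le (by fun_prop) (by fun_prop)) (by fun_prop) (by fun_prop)
  have hg0 : ∀ t, 0 ≤ t → ∀ x, 0 ≤ g t x := by
    intro t ht x
    simp only [g]
    split_ifs <;> positivity
  have hgb : ∀ t, 0 ≤ t → t ≤ 1 → ∀ x, g t x ≤ (3 * U ^ 2 + 2) * min 1 (x ^ 2) := by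
    intro t ht ht1 x
    simp only [g]
    split_ifs with hx
    · have : x ^ 2 ≤ 1 := by rw [← sq_abs]; exact pow_le_one₀ (abs_nonneg x) hx
      rw [min_eq_right this]
      refine (min_le_left _ _).trans ?_
      nlinarith [sq_nonneg x]
    · have : 1 ≤ x ^ 2 := by
        rw [← sq_abs]
        exact one_le_pow₀ (le_of_not_ge hx)
      rw [min_eq_left this]
      nlinarith [sq_nonneg U]
  have hgi : ∀ t, 0 ≤ t → t ≤ 1 → Integrable (g t) ν := by
    intro t ht ht1
    refine (hν.integrable_min.const_mul (3 * U ^ 2 + 2)).mono' (hgm t).aestronglyMeasurable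
      (Eventually.of_forall fun x => ?_)
    rw [Real.norm_of_nonneg (hg0 t ht x)]
    exact hgb t ht ht1 x
  have hev : ∀ᶠ t in 𝓝[>] (0 : ℝ), 0 < t ∧ t ≤ 1 := by
    filter_upwards [Ioc_mem_nhdsGT (zero_lt_one' ℝ)] with t ht using ht
  have hsq : Tendsto (fun t : ℝ => Real.sqrt t) (𝓝[>] 0) (𝓝 0) := by
    have := Real.continuous_sqrt.tendsto 0
    rw [Real.sqrt_zero] at this
    exact this.mono_left nhdsWithin_le_nhds
  have hid : Tendsto (fun t : ℝ => t) (𝓝[>] 0) (𝓝 0) := tendsto_id.mono_left nhdsWithin_le_nhds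
  have hlim : Tendsto (fun t => ∫ x, g t x ∂ν) (𝓝[>] 0) (𝓝 (∫ _, (0 : ℝ) ∂ν)) := by
    refine tendsto_integral_filter_of_dominated_convergence
      (fun x => (3 * U ^ 2 + 2) * min 1 (x ^ 2))
      (Eventually.of_forall fun t => (hgm t).aestronglyMeasurable) ?_
      (hν.integrable_min.const_mul _) (Eventually.of_forall fun x => ?_)
    · filter_upwards [hev] with t ht
      refine Eventually.of_forall fun x => ?_
      rw [Real.norm_of_nonneg (hg0 t ht.1.le x)]
      exact hgb t ht.1.le ht.2 x
    · have h1 : Tendsto (fun t : ℝ => 2 * t + Real.sqrt t * (U * |x|)) (𝓝[>] 0) (𝓝 0) := by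
        simpa using (hid.const_mul 2).add (hsq.mul_const (U * |x|))
      have h2 : Tendsto (fun t : ℝ => 2 * t) (𝓝[>] 0) (𝓝 0) := by
        simpa using hid.const_mul 2
      by_cases hx : |x| ≤ 1
      · simp only [g, hx, if_true]
        refine tendsto_of_tendsto_of_tendsto_of_le_of_le' tendsto_const_nhds h1 ?_
          (Eventually.of_forall fun t => min_le_right _ _)
        filter_upwards [hev] with t ht
        have := ht.1
        positivity
      · simpa only [g, hx, if_false] using h2
  have hlim2 : Tendsto (fun t => Real.sqrt t * (|b| * U) + ∫ x, g t x ∂ν) (𝓝[>] 0) (𝓝 0) := by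
    simpa using (hsq.mul_const (|b| * U)).add hlim
  filter_upwards [hev, hlim2.eventually_le_const hε] with t ht hle w hw
  refine le_trans ?_ hle
  have ht0 := ht.1
  have hst : Real.sqrt t * Real.sqrt t = t := Real.mul_self_sqrt ht0.le
  have htw : t * |w| ≤ Real.sqrt t * U := by
    calc t * |w| = Real.sqrt t * (|w| * Real.sqrt t) := by
          linear_combination (-|w|) * hst
      _ ≤ _ := by gcongr
  have htw2 : t * w ^ 2 ≤ U ^ 2 := by
    calc t * w ^ 2 = (|w| * Real.sqrt t) ^ 2 := by
          rw [mul_pow, sq_abs, Real.sq_sqrt ht0.le, mul_comm]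
      _ ≤ _ := by gcongr
  have hint : t * ‖∫ x : ℝ, (Complex.exp (Complex.I * w * x) - 1
      - if |x| ≤ 1 then Complex.I * w * x else 0) ∂ν‖ ≤ ∫ x, g t x ∂ν := by
    have h1 : t * ‖∫ x : ℝ, (Complex.exp (Complex.I * w * x) - 1
      - if |x| ≤ 1 then Complex.I * w * x else 0) ∂ν‖ = ‖∫ x : ℝ, (t : ℂ) *
      (Complex.exp (Complex.I * w * x) - 1 - if |x| ≤ 1 then Complex.I * w * x else 0) ∂ν‖ := by
      rw [integral_const_mul, norm_mul, Complex.norm_real, Real.norm_of_nonneg ht0.le]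
    rw [h1]
    refine norm_integral_le_of_norm_le (hgi t ht0.le ht.2) (Eventually.of_forall fun x => ?_)
    rw [norm_mul, Complex.norm_real, Real.norm_of_nonneg ht0.le]
    have h2 := norm_exp_mul_I_sub_one_sub_le (w * x)
    push_cast at h2
    rw [← mul_assoc] at h2
    simp only [g]
    split_ifs with hx
    · refine le_min ?_ ?_
      · calc _ ≤ t * (3 * (w * x) ^ 2) := by gcongr; exact h2.2.2
          _ = 3 * (t * w ^ 2) * x ^ 2 := by ring
          _ ≤ _ := by gcongr
      · calc _ ≤ t * (2 + |w * x|) := by gcongr; exact h2.2.1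
          _ = 2 * t + t * |w| * |x| := by rw [abs_mul]; ring
          _ ≤ 2 * t + Real.sqrt t * U * |x| := by gcongr
          _ = _ := by ring
    · rw [sub_zero, mul_comm]
      gcongr
      exact h2.1
  unfold levyExponent
  calc _ ≤ t * (‖Complex.I * b * w - ((0 : ℝ) : ℂ) * w ^ 2 / 2‖ + ‖∫ x : ℝ,
          (Complex.exp (Complex.I * w * x) - 1
            - if |x| ≤ 1 then Complex.I * w * x else 0) ∂ν‖) := by
        gcongr
        exact norm_add_le _ _
    _ = |b| * (t * |w|) + t * ‖∫ x : ℝ, (Complex.exp (Complex.I * w * x) - 1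
            - if |x| ≤ 1 then Complex.I * w * x else 0) ∂ν‖ := by
        simp
        ring
    _ ≤ |b| * (Real.sqrt t * U) + ∫ x, g t x ∂ν := by gcongr
    _ = _ := by ring

/-- A probability measure whose characteristic function has modulus one is a Dirac measure. -/
lemma exists_ae_eq_of_norm_charFun_eq_one {m : Measure ℝ} [IsProbabilityMeasure m]
    (h : ∀ u, ‖charFun m u‖ = 1) : ∃ c, ∀ᵐ x ∂m, x = c := by
  have hneg : Measurable fun x : ℝ => -x := measurable_neg
  have : IsProbabilityMeasure (m.map fun x => -x) :=
    Measure.isProbabilityMeasure_map hneg.aemeasurable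
  -- The symmetrisation of `m` has characteristic function `‖charFun m u‖ ^ 2 = 1`. So two
  -- independent copies agree almost surely, and by Fubini almost every point equals one fixed value
  -- `c`.
  have hconv : m.conv (m.map fun x => -x) = Measure.dirac 0 := by
    refine Measure.ext_of_charFun (funext fun u => ?_)
    have h1 : charFun (m.map fun x => -x) u = charFun m (-u) := by
      have := charFun_map_mul (μ := m) (-1) u
      simpa using this
    rw [charFun_conv, h1, charFun_neg, Complex.mul_conj, Complex.normSq_eq_norm_sq, h u]
    simp
  have hae : ∀ᵐ z ∂(m.conv (m.map fun x => -x)), z = 0 := by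
    rw [hconv]
    exact (ae_dirac_iff (p := fun z : ℝ => z = 0) measurableSet_eq).2 rfl
  rw [Measure.conv, ae_map_iff (p := fun z : ℝ => z = 0) (by fun_prop) measurableSet_eq] at hae
  obtain ⟨c, hc⟩ := (Measure.ae_ae_of_ae_prod hae).exists
  refine ⟨c, ?_⟩
  rw [ae_map_iff (by fun_prop) (measurableSet_eq_fun (by fun_prop) (by fun_prop))] at hc
  filter_upwards [hc] with x hx
  linarith

section Core

variable {m : Measure ℝ} [IsProbabilityMeasure m] {t : ℝ}

/-- Since `1 - cos y ≤ y² / 2`, the second moment controls `1 - Re φ(u) ≥ 1 - |φ(u)| = 1 - exp (-t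
ρ)`, which is at least linear in `t` on `(0, 1]`. Using `u² + 1` rather than `u²` avoids showing `u
≠ 0`. -/
lemma le_integral_sq_of_charFun {ψ : ℂ} {u ρ : ℝ} (hm : Integrable (fun x : ℝ => x ^ 2) m)
    (hφ : charFun m u = Complex.exp (t * ψ)) (hψ : ψ.re = -ρ) (hρ : 0 < ρ) (ht : 0 < t)
    (ht1 : t ≤ 1) : 2 * ρ / ((1 + ρ) * (u ^ 2 + 1)) * t ≤ ∫ x, x ^ 2 ∂m := by
  have hnorm : ‖charFun m u‖ = Real.exp (-(t * ρ)) := by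
    rw [hφ, Complex.norm_exp]
    simp [hψ]
  have hre : (charFun m u).re = ∫ x, Real.cos (u * x) ∂m := by
    rw [charFun_apply_real]
    have hi : Integrable (fun x : ℝ => Complex.exp (u * x * Complex.I)) m := by
      refine (integrable_const (1 : ℝ)).mono' (by fun_prop) (Eventually.of_forall fun x => ?_)
      have := Complex.norm_exp_ofReal_mul_I (u * x)
      push_cast at this
      exact this.le
    have := integral_re hi
    simp only [RCLike.re_to_complex] at this
    rw [← this]
    refine integral_congr_ae (Eventually.of_forall fun x => ?_)
    have h1 := Complex.exp_ofReal_mul_I_re (u * x)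
    push_cast at h1
    exact h1
  have hcos : Integrable (fun x : ℝ => Real.cos (u * x)) m := by
    refine (integrable_const (1 : ℝ)).mono' (by fun_prop) (Eventually.of_forall fun x => ?_)
    exact Real.abs_cos_le_one _
  have h1 : 1 - ∫ x, Real.cos (u * x) ∂m ≤ u ^ 2 / 2 * ∫ x, x ^ 2 ∂m := by
    have h2 : 1 - ∫ x, Real.cos (u * x) ∂m = ∫ x, (1 - Real.cos (u * x)) ∂m := by
      rw [integral_sub (integrable_const _) hcos]
      simp
    rw [h2, ← integral_const_mul]
    refine integral_mono ((integrable_const _).sub hcos) (hm.const_mul _) fun x => ?_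
    have := Real.one_sub_sq_div_two_le_cos (x := u * x)
    simp only
    nlinarith
  have h3 : t * ρ / (1 + ρ) ≤ 1 - Real.exp (-(t * ρ)) := by
    have hy : 0 < t * ρ := by positivity
    have h4 : Real.exp (-(t * ρ)) ≤ 1 / (1 + t * ρ) := by
      rw [Real.exp_neg, ← one_div]
      exact one_div_le_one_div_of_le (by positivity) (by linarith [Real.add_one_le_exp (t * ρ)])
    have h5 : t * ρ / (1 + ρ) ≤ t * ρ / (1 + t * ρ) := by
      gcongr
      nlinarith
    have h6 : 1 - 1 / (1 + t * ρ) = t * ρ / (1 + t * ρ) := by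
      field_simp
      ring
    linarith
  have h7 : 1 - Real.exp (-(t * ρ)) ≤ 1 - ∫ x, Real.cos (u * x) ∂m := by
    rw [← hnorm, ← hre]
    linarith [Complex.re_le_norm (charFun m u)]
  have h8 : 0 ≤ ∫ x, x ^ 2 ∂m := integral_nonneg fun x => sq_nonneg x
  have h9 : t * ρ / (1 + ρ) ≤ (u ^ 2 + 1) / 2 * ∫ x, x ^ 2 ∂m := by
    refine (h3.trans (h7.trans h1)).trans ?_
    gcongr
    linarith
  have h10 : 2 * ρ / ((1 + ρ) * (u ^ 2 + 1)) * t = t * ρ / (1 + ρ) / ((u ^ 2 + 1) / 2) := by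
    field_simp
  rw [h10, div_le_iff₀' (by positivity)]
  exact h9

/-- Cut at `r = ε σ`. The characteristic function is close to one on `|u| ≤ 2 / r`, so `|x| > r` has
mass at most `ε²`. There the weighted inequality `|x| ≤ ε x² / (2σ) + σ / (2ε)` replaces
Cauchy–Schwarz, and the three contributions are `εσ`, `εσ / 2` and `εσ / 2`. -/
lemma integral_abs_le_of_charFun {ψ : ℝ → ℂ} {σ ε : ℝ} (hm : Integrable (fun x : ℝ => x ^ 2) m)
    (hσ : 0 < σ) (hσ2 : ∫ x, x ^ 2 ∂m = σ ^ 2) (hε : 0 < ε) (hε1 : ε ≤ 1)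
    (hφ : ∀ u, charFun m u = Complex.exp (t * ψ u)) (ht : 0 < t)
    (hψ : ∀ u, |u| ≤ 2 / (ε * σ) → t * ‖ψ u‖ ≤ ε ^ 2 / 4) : ∫ x, |x| ∂m ≤ 2 * ε * σ := by
  obtain ⟨r, hr⟩ : ∃ r, r = ε * σ := ⟨_, rfl⟩
  have hr0 : 0 < r := by
    rw [hr]
    positivity
  rw [← hr] at hψ
  have hP : m.real {x | r < |x|} ≤ ε ^ 2 := by
    refine (measureReal_abs_gt_le_integral_charFun hr0).trans ?_
    have h1 : ‖∫ u in (-2 * r⁻¹)..(2 * r⁻¹), 1 - charFun m u‖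
        ≤ ε ^ 2 / 2 * |2 * r⁻¹ - -2 * r⁻¹| := by
      refine intervalIntegral.norm_integral_le_of_norm_le_const fun u hu => ?_
      have hle : -2 * r⁻¹ ≤ 2 * r⁻¹ := by
        have : 0 < r⁻¹ := by positivity
        linarith
      rw [Set.uIoc_of_le hle] at hu
      have hu' : |u| ≤ 2 / r := by
        rw [abs_le, div_eq_mul_inv]
        exact ⟨by linarith [hu.1], hu.2⟩
      have h2 := hψ u hu'
      have h3 : ‖(t : ℂ) * ψ u‖ = t * ‖ψ u‖ := by
        rw [norm_mul, Complex.norm_real, Real.norm_of_nonneg ht.le]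
      rw [hφ, norm_sub_rev]
      refine (Complex.norm_exp_sub_one_le ?_).trans ?_
      · rw [h3]
        nlinarith
      · rw [h3]
        linarith
    calc 2⁻¹ * r * ‖∫ u in (-2 * r⁻¹)..(2 * r⁻¹), 1 - charFun m u‖
        ≤ 2⁻¹ * r * (ε ^ 2 / 2 * |2 * r⁻¹ - -2 * r⁻¹|) := by gcongr
      _ = ε ^ 2 := by
        have h4 : 2 * r⁻¹ - -2 * r⁻¹ = 4 * r⁻¹ := by ring
        rw [h4, abs_of_pos (by positivity)]
        field_simp
        norm_num
  have hset : MeasurableSet {x : ℝ | r < |x|} := by measurability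
  have hind : Integrable ({x : ℝ | r < |x|}.indicator fun _ => (1 : ℝ)) m :=
    (integrable_const 1).indicator hset
  have hint1 : Integrable (fun x : ℝ => ε / σ * x ^ 2 / 2) m := by
    simpa [mul_div_right_comm] using hm.const_mul (ε / σ / 2)
  have hint2 : Integrable (fun x : ℝ => ε / σ * x ^ 2 / 2 +
      σ / (2 * ε) * {x : ℝ | r < |x|}.indicator (fun _ => (1 : ℝ)) x) m :=
    hint1.add (hind.const_mul _)
  have hint : Integrable (fun x : ℝ => r + (ε / σ * x ^ 2 / 2 +
      σ / (2 * ε) * {x : ℝ | r < |x|}.indicator (fun _ => (1 : ℝ)) x)) m :=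
    (integrable_const r).add hint2
  calc ∫ x, |x| ∂m ≤ ∫ x, (r + (ε / σ * x ^ 2 / 2 +
      σ / (2 * ε) * {x : ℝ | r < |x|}.indicator (fun _ => (1 : ℝ)) x)) ∂m := by
        refine integral_mono_of_nonneg (Eventually.of_forall fun x => abs_nonneg x) hint
          (Eventually.of_forall fun x => ?_)
        simp only
        by_cases hx : r < |x|
        · rw [Set.indicator_of_mem (by exact hx), mul_one]
          have h5 : |x| ≤ ε / σ * x ^ 2 / 2 + σ / (2 * ε) := by
            have h6 : ε / σ * x ^ 2 / 2 + σ / (2 * ε) - |x| = (ε * |x| - σ) ^ 2 / (2 * ε * σ) := by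
              rw [← sq_abs x]
              field_simp
              ring
            have h7 : 0 ≤ (ε * |x| - σ) ^ 2 / (2 * ε * σ) := by positivity
            linarith
          linarith
        · rw [Set.indicator_of_notMem (by exact hx), mul_zero, add_zero]
          have : 0 ≤ ε / σ * x ^ 2 / 2 := by positivity
          linarith
    _ = r + (ε / σ / 2 * σ ^ 2 + σ / (2 * ε) * m.real {x | r < |x|}) := by
        have h8 : ∫ x, ε / σ * x ^ 2 / 2 ∂m = ε / σ / 2 * σ ^ 2 := by
          rw [← hσ2, ← integral_const_mul]
          exact integral_congr_ae (Eventually.of_forall fun x => by ring)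
        have h9 : ∫ x, {x : ℝ | r < |x|}.indicator (fun _ => (1 : ℝ)) x ∂m = m.real {x | r < |x|} :=
          integral_indicator_one hset
        rw [integral_add (integrable_const r) hint2,
          integral_add hint1 (hind.const_mul _), integral_const_mul, h8, h9]
        simp
    _ ≤ r + (ε / σ / 2 * σ ^ 2 + σ / (2 * ε) * ε ^ 2) := by gcongr
    _ = 2 * ε * σ := by
        rw [hr]
        field_simp
        ring

end Core

lemma toReal_eLpNorm_two {Ω : Type*} [MeasurableSpace Ω] {P : Measure Ω} {X : Ω → ℝ}
    (hX : MemLp X 2 P) :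
    (eLpNorm X 2 P).toReal = Real.sqrt (∫ ω, X ω ^ 2 ∂P) := by
  rw [hX.eLpNorm_eq_integral_rpow_norm (by simp) (by simp), ENNReal.toReal_ofReal (by positivity),
    Real.sqrt_eq_rpow]
  simp

lemma toReal_eLpNorm_one {Ω : Type*} [MeasurableSpace Ω] {P : Measure Ω} {X : Ω → ℝ}
    (hX : MemLp X 1 P) :
    (eLpNorm X 1 P).toReal = ∫ ω, |X ω| ∂P := by
  rw [hX.eLpNorm_eq_integral_rpow_norm (by simp) (by simp), ENNReal.toReal_ofReal (by positivity)]
  simp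

lemma integral_sq_levyLaw {Ω : Type*} [MeasurableSpace Ω] {P : Measure Ω} {t₀ : ℝ}
    {Y : Set.Icc (0 : ℝ) t₀ → Ω → ℝ} (hY : IsLevyProcess P Y) (h₀ : 0 ≤ t₀) (t : Set.Icc (0 : ℝ) t₀) :
    ∫ x, x ^ 2 ∂(levyLaw P h₀ Y t) = ∫ ω, Y t ω ^ 2 ∂P := by
  rw [levyLaw_coe, integral_map (hY.measurable t).aemeasurable (by fun_prop)]

/-! ### Comparison of first and second moments as time tends to zero, and failure of `C_q` for `q ≥
2`. -/

section SmallTime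

variable {Ω : Type*} [MeasurableSpace Ω] {P : Measure Ω} [IsProbabilityMeasure P] {t₀ : ℝ}
  {Y : Set.Icc (0 : ℝ) t₀ → Ω → ℝ} {Λ : Set ℝ → Ω → ℝ}

/-- Otherwise every characteristic function has modulus one, and every `Y_t` is constant. -/
lemma exists_re_levyExponent_neg (hY : IsLevyProcess P Y) {b v : ℝ} {ν : Measure ℝ}
    (htrip : HasLevyTriplet P Y b v ν) (hdet : ¬ IsDeterministic P Y) :
    ∃ u, (levyExponent b v ν u).re < 0 := by
  by_contra! hcon
  refine hdet fun t => ?_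
  have : IsProbabilityMeasure (P.map (Y t)) :=
    Measure.isProbabilityMeasure_map (hY.measurable t).aemeasurable
  obtain ⟨c, hc⟩ := exists_ae_eq_of_norm_charFun_eq_one (m := P.map (Y t)) fun u => by
    refine le_antisymm (norm_charFun_le_one u) ?_
    rw [htrip.2.2 t u, Complex.norm_exp, Complex.re_ofReal_mul]
    exact Real.one_le_exp (mul_nonneg t.2.1 (hcon u))
  exact ⟨c, ae_of_ae_map (hY.measurable t).aemeasurable hc⟩

/-- The first absolute moment of a square-integrable Lévy process without Gaussian component is of
smaller order than the root of the second moment, as time tends to zero. -/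
theorem eventually_integral_abs_le (hY : IsLevyProcess P Y) (h₀ : 0 ≤ t₀) {b : ℝ} {ν : Measure ℝ}
    (htrip : HasLevyTriplet P Y b 0 ν) (hdet : ¬ IsDeterministic P Y)
    (h2 : ∀ t, 0 < t → t ≤ t₀ → Integrable (fun x : ℝ => x ^ 2) (levyLaw P h₀ Y t)) {ε : ℝ}
    (hε : 0 < ε) : ∀ᶠ t in 𝓝[>] (0 : ℝ), t ≤ t₀ → 0 < ∫ x, x ^ 2 ∂(levyLaw P h₀ Y t) ∧
      ∫ x, |x| ∂(levyLaw P h₀ Y t) ≤ ε * Real.sqrt (∫ x, x ^ 2 ∂(levyLaw P h₀ Y t)) := by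
  obtain ⟨u₀, hu₀⟩ := exists_re_levyExponent_neg hY htrip hdet
  set ρ := -(levyExponent b 0 ν u₀).re with hρ
  have hρ0 : 0 < ρ := neg_pos.2 hu₀
  set c := 2 * ρ / ((1 + ρ) * (u₀ ^ 2 + 1)) with hc
  have hc0 : 0 < c := by positivity
  set η := min 1 (ε / 2) with hη
  have hη0 : 0 < η := lt_min one_pos (by linarith)
  have hsc : 0 < Real.sqrt c := Real.sqrt_pos.2 hc0
  -- The moment bound needs the exponent on `|u| ≤ 2 / (η σ)`. As `σ ≥ √c √t`, there `|u| √t ≤ 2 /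
  -- (η √c)`, which is the value of `U`.
  have hev := eventually_mul_norm_levyExponent_le (b := b) htrip.2.1
    (U := 2 / (η * Real.sqrt c)) (ε := η ^ 2 / 4) (by positivity) (by positivity)
  filter_upwards [hev, Ioc_mem_nhdsGT (zero_lt_one' ℝ)] with t ht ht1 htt
  have hpos : 0 < t := ht1.1
  have := hY.isProbabilityMeasure_levyLaw (h₀ := h₀) t
  have hφ : ∀ u, charFun (levyLaw P h₀ Y t) u = Complex.exp (t * levyExponent b 0 ν u) := by
    intro u
    have h3 := htrip.2.2 ⟨t, hpos.le, htt⟩ u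
    rwa [← levyLaw_coe (h₀ := h₀)] at h3
  have hlow := le_integral_sq_of_charFun (h2 t hpos htt) (hφ u₀) (ρ := ρ) (by simp [hρ]) hρ0 hpos
    ht1.2
  rw [← hc] at hlow
  have hS : 0 < ∫ x, x ^ 2 ∂(levyLaw P h₀ Y t) := lt_of_lt_of_le (by positivity) hlow
  set σ := Real.sqrt (∫ x, x ^ 2 ∂(levyLaw P h₀ Y t)) with hσ
  have hσ0 : 0 < σ := Real.sqrt_pos.2 hS
  have hσ2 : σ ^ 2 = ∫ x, x ^ 2 ∂(levyLaw P h₀ Y t) := Real.sq_sqrt hS.le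
  have hσc : Real.sqrt c * Real.sqrt t ≤ σ := by
    rw [← Real.sqrt_mul hc0.le]
    exact Real.sqrt_le_sqrt hlow
  refine ⟨hS, ?_⟩
  refine (integral_abs_le_of_charFun (h2 t hpos htt) hσ0 hσ2.symm hη0 (min_le_left _ _) hφ hpos
    fun u hu => ht u ?_).trans ?_
  · have hst : 0 < Real.sqrt t := Real.sqrt_pos.2 hpos
    calc |u| * Real.sqrt t ≤ 2 / (η * (Real.sqrt c * Real.sqrt t)) * Real.sqrt t := by
          gcongr
          exact hu.trans (by gcongr)
      _ = 2 / (η * Real.sqrt c) := by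
          field_simp
  · have : 2 * η ≤ ε := by
      have := min_le_right 1 (ε / 2)
      linarith
    gcongr

theorem tendsto_eLpNorm_div_eLpNorm (hY : IsLevyProcess P Y) (h₀ : 0 ≤ t₀)
    (hdet : ¬ IsDeterministic P Y) (hgauss : HasNoGaussianComponent P Y)
    (h2 : ∀ t, MemLp (Y t) 2 P) :
    Tendsto (fun t => (eLpNorm (Y t) 2 P).toReal / (eLpNorm (Y t) 1 P).toReal)
        (comap (fun t : Set.Icc (0 : ℝ) t₀ => (t : ℝ)) (𝓝[>] 0)) atTop := by
  obtain ⟨b, ν, htrip⟩ := hgauss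
  rw [tendsto_atTop]
  intro M
  have hε : 0 < 1 / (|M| + 1) := by positivity
  have h3 : ∀ t, 0 < t → t ≤ t₀ → Integrable (fun x : ℝ => x ^ 2) (levyLaw P h₀ Y t) := by
    intro t ht htt
    have h4 : levyLaw P h₀ Y t = P.map (Y ⟨t, ht.le, htt⟩) := levyLaw_coe ⟨t, ht.le, htt⟩
    rw [h4, integrable_map_measure (by fun_prop) (hY.measurable _).aemeasurable]
    exact (h2 _).integrable_sq
  have hev := (eventually_integral_abs_le hY h₀ htrip hdet h3 hε).comap
    (fun t : Set.Icc (0 : ℝ) t₀ => (t : ℝ))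
  filter_upwards [hev] with t ht
  obtain ⟨hS, hA⟩ := ht t.2.2
  rw [integral_sq_levyLaw hY] at hS hA
  rw [levyLaw_coe, integral_map (hY.measurable t).aemeasurable (by fun_prop)] at hA
  have h1 : MemLp (Y t) 1 P := (h2 t).mono_exponent (by norm_num)
  -- A vanishing denominator would make the quotient zero by convention, so positivity has to be
  -- derived from the second moment.
  have hpos : 0 < ∫ ω, |Y t ω| ∂P := by
    refine lt_of_le_of_ne (integral_nonneg fun ω => abs_nonneg _) fun h0 => hS.ne' ?_
    rw [eq_comm, integral_eq_zero_iff_of_nonneg (fun ω => abs_nonneg _)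
      (memLp_one_iff_integrable.1 h1).abs] at h0
    rw [integral_eq_zero_iff_of_nonneg (fun ω => sq_nonneg _) (h2 t).integrable_sq]
    filter_upwards [h0] with ω hω
    simpa using hω
  rw [toReal_eLpNorm_two (h2 t), toReal_eLpNorm_one h1, le_div_iff₀ hpos]
  rw [one_div, ← div_eq_inv_mul, le_div_iff₀ (by positivity)] at hA
  have := le_abs_self M
  nlinarith

/-- At `s = c` the condition gives `E[Z²] ≤ (1 + β₂) c²`, while Markov's inequality gives `β₁ c ≤
E|Z|`. The unknown `c` drops out. -/
lemma SatisfiesCFinite.sq_integrable {I : Type*} {𝓗 : I → Set (Ω → ℝ)}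
    (h : SatisfiesCFinite P 𝓗 2) (hm : ∀ ξ, ∀ Z ∈ 𝓗 ξ, Measurable Z) :
    ∃ κ : ℝ, 0 < κ ∧ ∀ ξ, ∀ Z ∈ 𝓗 ξ, Integrable (fun ω => Z ω ^ 2) P ∧
      Real.sqrt (∫ ω, Z ω ^ 2 ∂P) ≤ κ * ∫ ω, |Z ω| ∂P := by
  obtain ⟨β₁, β₂, hβ₁, hβ₂, h3⟩ := h
  refine ⟨Real.sqrt (1 + β₂) / β₁, by positivity, fun ξ Z hZ => ?_⟩
  obtain ⟨c, hc, hcP, hs⟩ := h3 ξ Z hZ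
  have hZm := hm ξ Z hZ
  have hmeas : MeasurableSet {ω | c < |Z ω|} := by measurability
  have hle : ∫⁻ ω, ENNReal.ofReal (Z ω ^ 2) ∂P ≤ ENNReal.ofReal (c ^ 2 * (1 + β₂)) := by
    rw [← lintegral_add_compl _ hmeas]
    calc _ ≤ ENNReal.ofReal (β₂ * c ^ 2) * 1 + ENNReal.ofReal (c ^ 2) * 1 := by
          refine add_le_add ?_ ?_
          · have h4 := hs c le_rfl
            simp only [Real.rpow_two, sq_abs] at h4
            exact h4.trans (by gcongr; exact prob_le_one)
          · calc _ ≤ ∫⁻ ω in {ω | c < |Z ω|}ᶜ, ENNReal.ofReal (c ^ 2) ∂P := by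
                  refine setLIntegral_mono' hmeas.compl fun ω hω => ENNReal.ofReal_le_ofReal ?_
                  have hω' : |Z ω| ≤ c := not_lt.1 hω
                  rw [← sq_abs]
                  gcongr
              _ ≤ _ := by
                  rw [setLIntegral_const]
                  gcongr
                  exact prob_le_one
      _ = _ := by
          rw [mul_one, mul_one, ← ENNReal.ofReal_add (by positivity) (by positivity)]
          congr 1
          ring
  have hint : Integrable (fun ω => Z ω ^ 2) P := by
    refine ⟨by fun_prop, ?_⟩
    rw [hasFiniteIntegral_iff_ofReal (Eventually.of_forall fun ω => sq_nonneg _)]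
    exact hle.trans_lt ENNReal.ofReal_lt_top
  refine ⟨hint, ?_⟩
  have hS : ∫ ω, Z ω ^ 2 ∂P ≤ c ^ 2 * (1 + β₂) := by
    rw [← ofReal_integral_eq_lintegral_ofReal hint (Eventually.of_forall fun ω => sq_nonneg _),
      ENNReal.ofReal_le_ofReal_iff (by positivity)] at hle
    exact hle
  have hZi : Integrable Z P := ((memLp_two_iff_integrable_sq hZm.aestronglyMeasurable).2
    hint).integrable (by norm_num)
  have hA : β₁ * c ≤ ∫ ω, |Z ω| ∂P := by
    refine le_trans ?_ (mul_meas_ge_le_integral_of_nonneg (Eventually.of_forall fun ω =>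
      abs_nonneg (Z ω)) hZi.abs c)
    rw [mul_comm]
    gcongr
    exact (ENNReal.ofReal_le_iff_le_toReal (measure_ne_top _ _)).1 hcP
  calc Real.sqrt (∫ ω, Z ω ^ 2 ∂P) ≤ Real.sqrt (c ^ 2 * (1 + β₂)) := Real.sqrt_le_sqrt hS
    _ = Real.sqrt (1 + β₂) / β₁ * (β₁ * c) := by
        rw [Real.sqrt_mul (by positivity), Real.sqrt_sq hc.le]
        field_simp
    _ ≤ _ := by gcongr

/-- For `W = Z - E Z` with variance `V`, one has `V ≤ ‖W‖_∞ E|W| ≤ β √V · 2 E|Z|` with `β` the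
positive part of the constant. Cancel `√V` and add `(E Z)² ≤ (E|Z|)²`. -/
lemma SatisfiesCTop.sq_integrable {I : Type*} {𝓗 : I → Set (Ω → ℝ)}
    (h : SatisfiesCTop P 𝓗) :
    ∃ κ : ℝ, 0 ≤ κ ∧ ∀ ξ, ∀ Z ∈ 𝓗 ξ, Integrable (fun ω => Z ω ^ 2) P ∧
      ∫ ω, Z ω ^ 2 ∂P ≤ κ * (∫ ω, |Z ω| ∂P) ^ 2 := by
  obtain ⟨h1, β, hβ⟩ := h
  refine ⟨4 * (max β 0) ^ 2 + 1, by positivity, fun ξ Z hZ => ?_⟩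
  have hZi : Integrable Z P := memLp_one_iff_integrable.1 (h1 ξ Z hZ)
  obtain ⟨hne, hle⟩ := hβ ξ Z hZ
  set M := ∫ ω, Z ω ∂P with hM
  set W : Ω → ℝ := fun ω => Z ω - M with hW
  have hWi : Integrable W P := hZi.sub (integrable_const M)
  have hWtop : MemLp W ∞ P := ⟨hWi.1, hne.lt_top⟩
  have hW2 : MemLp W 2 P := hWtop.mono_exponent le_top
  have hZ2 : MemLp Z 2 P := by
    have := hW2.add (memLp_const M)
    convert this using 1
    ext ω
    simp [hW]
  refine ⟨hZ2.integrable_sq, ?_⟩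
  set B := (eLpNorm W ∞ P).toReal with hB
  set V := ∫ ω, W ω ^ 2 ∂P with hV
  have hV0 : 0 ≤ V := integral_nonneg fun ω => sq_nonneg _
  have hBV : B ≤ max β 0 * Real.sqrt V := by
    have h3 := ENNReal.toReal_mono (ENNReal.mul_ne_top ENNReal.ofReal_ne_top hW2.2.ne) hle
    rw [ENNReal.toReal_mul, toReal_eLpNorm_two hW2, ENNReal.toReal_ofReal'] at h3
    exact h3
  have hVB : V ≤ B * ∫ ω, |W ω| ∂P := by
    rw [hV, ← integral_const_mul]
    refine integral_mono_ae hW2.integrable_sq (hWi.abs.const_mul B) ?_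
    have hae := ae_le_eLpNormEssSup (f := W) (μ := P)
    filter_upwards [hae] with ω hω
    rw [← eLpNorm_exponent_top] at hω
    have h4 := ENNReal.toReal_mono hne hω
    rw [toReal_enorm, Real.norm_eq_abs] at h4
    rw [← sq_abs, sq]
    gcongr
  have hMA : |M| ≤ ∫ ω, |Z ω| ∂P := abs_integral_le_integral_abs
  have hWA : ∫ ω, |W ω| ∂P ≤ 2 * ∫ ω, |Z ω| ∂P := by
    calc ∫ ω, |W ω| ∂P ≤ ∫ ω, (|Z ω| + |M|) ∂P :=
          integral_mono hWi.abs (hZi.abs.add (integrable_const _)) fun ω => abs_sub _ _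
      _ = (∫ ω, |Z ω| ∂P) + |M| := by
          rw [integral_add hZi.abs (integrable_const _)]
          simp
      _ ≤ _ := by linarith
  have hA0 : 0 ≤ ∫ ω, |Z ω| ∂P := integral_nonneg fun ω => abs_nonneg _
  have hVA : Real.sqrt V ≤ max β 0 * (2 * ∫ ω, |Z ω| ∂P) := by
    rcases hV0.eq_or_lt with h0 | h0
    · rw [← h0, Real.sqrt_zero]
      positivity
    · have hs := Real.sqrt_pos.2 h0
      have h5 : Real.sqrt V * Real.sqrt V ≤ max β 0 * (2 * ∫ ω, |Z ω| ∂P) * Real.sqrt V := by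
        rw [Real.mul_self_sqrt hV0]
        calc V ≤ B * ∫ ω, |W ω| ∂P := hVB
          _ ≤ max β 0 * Real.sqrt V * (2 * ∫ ω, |Z ω| ∂P) := by gcongr
          _ = _ := by ring
      exact le_of_mul_le_mul_right h5 hs
  have hS : ∫ ω, Z ω ^ 2 ∂P = V + M ^ 2 := by
    have h6 : ∀ ω, Z ω ^ 2 = W ω ^ 2 + (2 * M * Z ω - M ^ 2) := fun ω => by
      simp only [hW]
      ring
    simp_rw [h6]
    have h9 : Integrable (fun ω => 2 * M * Z ω - M ^ 2) P :=
      (hZi.const_mul _).sub (integrable_const _)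
    rw [integral_add hW2.integrable_sq h9,
      integral_sub (hZi.const_mul _) (integrable_const _), integral_const_mul, ← hM, ← hV]
    simp
    ring
  have h7 : V ≤ (max β 0 * (2 * ∫ ω, |Z ω| ∂P)) ^ 2 := by
    rw [← Real.sq_sqrt hV0]
    gcongr
  have h8 : M ^ 2 ≤ (∫ ω, |Z ω| ∂P) ^ 2 := by
    rw [← sq_abs]
    gcongr
  rw [hS]
  calc V + M ^ 2 ≤ _ := add_le_add h7 h8
    _ = _ := by ring

theorem not_satisfiesC_of_hasNoGaussianComponent (hY : IsLevyProcess P Y) (h₀ : 0 < t₀)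
    (hΛ : IsInducedRandomMeasure P Y Λ) (hdet : ¬ IsDeterministic P Y)
    (hgauss : HasNoGaussianComponent P Y) {q : ℝ≥0∞} (hq : 2 ≤ q) :
    ¬ SatisfiesC P (inducedFamily t₀ Λ) q := by
  rintro ⟨htop, hfin⟩
  have hm : ∀ ξ, ∀ Z ∈ inducedFamily t₀ Λ ξ, Measurable Z := fun ξ Z hZ =>
    (exists_law_of_mem_inducedFamily hY h₀.le hΛ ξ hZ).1
  obtain ⟨κ, hκ, hκZ⟩ : ∃ κ : ℝ, 0 ≤ κ ∧ ∀ ξ, ∀ Z ∈ inducedFamily t₀ Λ ξ,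
      Integrable (fun ω => Z ω ^ 2) P ∧ ∫ ω, Z ω ^ 2 ∂P ≤ κ * (∫ ω, |Z ω| ∂P) ^ 2 := by
    by_cases hqt : q = ∞
    · exact (htop hqt).sq_integrable
    · have h2q : (2 : ℝ) ≤ q.toReal := by
        have := ENNReal.toReal_mono hqt hq
        simpa using this
      obtain ⟨κ, hκ, h⟩ := ((hfin hqt).mono h2q hm).sq_integrable hm
      refine ⟨κ ^ 2, by positivity, fun ξ Z hZ => ⟨(h ξ Z hZ).1, ?_⟩⟩
      have h1 : 0 ≤ ∫ ω, Z ω ^ 2 ∂P := integral_nonneg fun ω => sq_nonneg _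
      rw [← Real.sq_sqrt h1, ← mul_pow]
      gcongr
      exact (h ξ Z hZ).2
  have hlaw : ∀ t, 0 < t → t ≤ t₀ → Integrable (fun x : ℝ => x ^ 2) (levyLaw P h₀.le Y t) ∧
      ∫ x, x ^ 2 ∂(levyLaw P h₀.le Y t) ≤ κ * (∫ x, |x| ∂(levyLaw P h₀.le Y t)) ^ 2 := by
    intro t ht htt
    obtain ⟨ξ, Z, hZ, hZt⟩ := exists_mem_inducedFamily hY h₀.le hΛ ht htt
    have hZm := (hm ξ Z hZ).aemeasurable (μ := P)
    rw [← hZt, integrable_map_measure (by fun_prop) hZm, integral_map hZm (by fun_prop),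
      integral_map hZm (by fun_prop)]
    exact hκZ ξ Z hZ
  obtain ⟨b, ν, htrip⟩ := hgauss
  -- With this constant the first moment squared is at most `S / (2 (κ + 1))`, where `S > 0` is the
  -- second moment, so the reverse inequality would give `S ≤ κ S / (2 (κ + 1)) < S`.
  have hε : 0 < 1 / Real.sqrt (2 * (κ + 1)) := by positivity
  have hev := eventually_integral_abs_le hY h₀.le htrip hdet (fun t ht htt => (hlaw t ht htt).1) hε
  obtain ⟨t, ht, htt⟩ := (hev.and (Ioc_mem_nhdsGT h₀)).exists
  obtain ⟨hS, hA⟩ := ht htt.2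
  have hle := (hlaw t htt.1 htt.2).2
  have hA0 : 0 ≤ ∫ x, |x| ∂(levyLaw P h₀.le Y t) := integral_nonneg fun x => abs_nonneg x
  have hA2 := pow_le_pow_left₀ hA0 hA 2
  rw [mul_pow, div_pow, Real.sq_sqrt hS.le, Real.sq_sqrt (by positivity), one_pow,
    one_div, ← div_eq_inv_mul, le_div_iff₀ (by positivity)] at hA2
  nlinarith

end SmallTime

end LevyChaos

theorem mainTheorem4 {Ω : Type*} [MeasurableSpace Ω] (P : Measure Ω) [IsProbabilityMeasure P]
    (t₀ : ℝ) (ht₀ : 1 ≤ t₀) (Y : Set.Icc (0 : ℝ) t₀ → Ω → ℝ)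
    (hY : LevyChaos.IsLevyProcess P Y) :
    (∀ Λ : Set ℝ → Ω → ℝ, LevyChaos.IsInducedRandomMeasure P Y Λ →
      ((∃ μ l : ℝ, 0 < μ ∧ 0 < l ∧
          P.map (Y ⟨1, zero_le_one, ht₀⟩) = LevyChaos.inverseGaussian μ l) →
        ∀ q : ℝ≥0∞, 0 < q →
          (LevyChaos.SatisfiesC P (LevyChaos.inducedFamily t₀ Λ) q ↔ q < 1 / 2)) ∧
      ((∃ α δ : ℝ, 0 < α ∧ 0 < δ ∧
          P.map (Y ⟨1, zero_le_one, ht₀⟩) = LevyChaos.symmetricNIG α δ) →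
        ∀ q : ℝ≥0∞, 0 < q →
          (LevyChaos.SatisfiesC P (LevyChaos.inducedFamily t₀ Λ) q ↔ q < 1)) ∧
      (¬ LevyChaos.IsDeterministic P Y → LevyChaos.HasNoGaussianComponent P Y →
        ∀ q : ℝ≥0∞, 2 ≤ q → ¬ LevyChaos.SatisfiesC P (LevyChaos.inducedFamily t₀ Λ) q)) ∧
    (¬ LevyChaos.IsDeterministic P Y → LevyChaos.HasNoGaussianComponent P Y →
      (∀ t, MemLp (Y t) 2 P) →
      Tendsto (fun t => (eLpNorm (Y t) 2 P).toReal / (eLpNorm (Y t) 1 P).toReal)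
        (comap (fun t : Set.Icc (0 : ℝ) t₀ => (t : ℝ)) (𝓝[>] 0)) atTop) := by
  have h₀ : 0 < t₀ := one_pos.trans_le ht₀
  refine ⟨fun Λ hΛ => ⟨?_, ?_, ?_⟩, fun hdet hgauss h2 =>
    LevyChaos.tendsto_eLpNorm_div_eLpNorm hY h₀.le hdet hgauss h2⟩
  · rintro ⟨μ, l, hμ, hl, h1⟩ q hq
    exact LevyChaos.satisfiesC_iff_of_inverseGaussian hY ht₀ hΛ hμ hl h1 hq
  · rintro ⟨α, δ, hα, hδ, h1⟩ q hq
    exact LevyChaos.satisfiesC_iff_of_symmetricNIG hY ht₀ hΛ hα hδ h1 hq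
  · intro hdet hgauss q hq
    exact LevyChaos.not_satisfiesC_of_hasNoGaussianComponent hY h₀ hΛ hdet hgauss hq
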